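/- **Delaying the Future in TSO.** *Model.* There are processes $1,\dots,n$, each with a local dispatcher $d_i$; the processes and the dispatchers are the agents. A TSO state consists of a memory $\mathsf m:\mathsf{Var}\to\mathsf{Val}$ and a FIFO store buffer $\mathsf{buf}_i\in(\mathsf{Var}\times\mathsf{Val})^*$ for every $i$. A process $i$ can perform: $\mathtt W[x,v]$ (append $\langle x,v\rangle$ to $\mathsf{buf}_i$); $\mathtt R[x]$ (an event $\mathtt{RfB}(x,v)$ if $\langle x,v\rangle$ is the latest item for $x$ in $\mathsf{buf}_i$, and an event $\mathtt{RfM}(x,\mathsf m(x))$ if $\mathsf{buf}_i$ has no item for $x$); $\mathtt F$ (enabled iff $\mathsf{buf}_i$ is empty); $\mathtt{RMW}[x,v,w]$ (enabled iff $\mathsf{buf}_i$ is empty and $\mathsf m(x)=v$; sets $\mathsf m(x):=w$); internal actions; and the null action $\bot$. The dispatcher $d_i$ can perform $\mathtt{prop}$ (enabled iff $\mathsf{buf}_i$ is nonempty; removes the oldest item $\langle x,v\rangle$ and sets $\mathsf m(x):=v$) or $\bot$. The events $\mathtt{RMW}(x,\cdot,\cdot)$, $\mathtt{prop}(x,\cdot)$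 and $\mathtt{RfM}(x,\cdot)$ are the memory accesses of $x$. Two events are conflicting if they are memory accesses of the same variable, are not both $\mathtt{RfM}$, and are not a $\mathtt{prop}$ at some $d_i$ together with an $\mathtt{RfM}$ at the same $i$. A run is an infinite sequence $r(0),r(1),\dots$ of global states (a TSO state and a local state $r_i(t)$ for every process $i$), with empty buffers and empty local states at time $0$, where $r(t+1)$ results from $r(t)$ by a joint action performed at time $t$. The joint action has one action for every agent, each enabled at $r(t)$, and at most one invocation of an operation for every process; no two of its events at distinct agents conflict. Within a round the actions take effect one by one, first those of the dispatchers, then those of the processes. (The other order would produce the same sequences of states; the order only decides that a read by $i$ of an item that $d_i$ propagates in the same round, and that is the latest item for its variable in $\mathsf{buf}_i$, counts as an $\mathtt{RfM}$.) The local state of $i$ is the list of the non-null actions of $i$ (reads with the value returned, but without the distinction between $\mathtt{RfB}$ and $\mathtt{RfM}$) and of the invocations at $i$ so far. A protocol $P$ assigns to every process $i$ and local state $\ell$ a nonempty set $P_i(\ell)$ of actions of $i$; $r$ is a run of $P$ if every non-null action of a process $i$ at a time $t$ is in $P_i(r_i(t))$. Runs $r,r'$ are locally equivalent, $r\approx r'$,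 if every process has the same set of local states in $r$ and in $r'$. A node is a pair $\langle b,t\rangle$ of an agent and a time. The $k$-th write of $i$ has the tag $\langle i,k\rangle$, and so has every $\mathtt{prop}$, $\mathtt{RfB}$ or $\mathtt{RfM}$ event that propagates or reads the item created by that write. The relation *occurs before* on the nodes of $r$ is the smallest transitive relation such that for all $t<t'$: 1. $\langle b,t\rangle$ occurs before $\langle b,t'\rangle$, for every agent $b$; 2. $\langle i,t\rangle$ occurs before $\langle d_i,t'\rangle$ if the former is a $\mathtt W$ or $\mathtt{RfB}$, the latter is a $\mathtt{prop}$, and they have the same tag; 3. $\langle b,t\rangle$ occurs before $\langle c,t'\rangle$ if both are memory accesses of the same variable, except if both are $\mathtt{RfM}$, or if $b=d_i$, $c=i$, the former is a $\mathtt{prop}$ and the latter an $\mathtt{RfM}$; 4. $\langle d_i,t\rangle$ occurs before $\langle i,t'\rangle$ if the former is a $\mathtt{prop}$ and the latter an $\mathtt F$ or $\mathtt{RMW}$. For a set $S$ of nodes, $\mathrm{Past}_r(S)$ is the set of nodes that occur before some node of $S$, and $\mathrm{Past}^+_r(S)=\mathrm{Past}_r(S)\cup S$. *Theorem.* Let $r$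 be a TSO run of a protocol $P$, let $S$ be a finite set of nodes, and let $\Delta\ge 0$ be an integer. Then there is a TSO run $r'\approx r$ of $P$ with $r'(0)=r(0)$ such that: (a) Every agent $b$ performs exactly the same actions (with the same tags) in the same order in both runs; the action that $b$ performs at time $t$ in $r$ is performed in $r'$ at time $t$ if $\langle b,t\rangle\in\mathrm{Past}_r(S)$, and at time $t+\Delta$ otherwise. Here an $\mathtt{RfM}$ in $r$ and an $\mathtt{RfB}$ in $r'$ with the same tag count as the same read action. (b) For every process $j$ and time $t$: $r_j(t)=r'_j(t)$ if $\langle j,t\rangle\in\mathrm{Past}^+_r(S)$, and $r_j(t)=r'_j(t+\Delta)$ otherwise. -/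

import Mathlib

namespace TSO

/-- The agents: the `n` processes and their local dispatchers. -/
inductive Agent (n : ℕ) : Type
  | proc (i : Fin n)
  | disp (i : Fin n)
  deriving DecidableEq

/-- A node: a point `⟨b, t⟩` on the timeline of the agent `b`. -/
abbrev Node (n : ℕ) : Type := Agent n × ℕ

/-- A tag `⟨i, k⟩` names the item created by the `k`-th write of process `i` (`k = 1, 2, …`). -/
abbrev Tag (n : ℕ) : Type := Fin n × ℕ

/-- Actions of agents. `prop` is the only non-null action of dispatchers, all the others are
actions of processes. `intl` are the internal actions, recorded in the local state only. -/
inductive Action (Var Val Intl : Type*)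
  | read (x : Var)
  | write (x : Var) (v : Val)
  | fence
  | rmw (x : Var) (vexp vnew : Val)
  | intl (a : Intl)
  | prop
  | null

/-- Events: actions taking place, with the values involved. A read is either a read from the
store buffer (`rfb`) or a read from memory (`rfm`). -/
inductive Event (Var Val Intl : Type*)
  | rfb (x : Var) (v : Val)
  | rfm (x : Var) (v : Val)
  | write (x : Var) (v : Val)
  | fence
  | rmw (x : Var) (vexp vnew : Val)
  | intl (a : Intl)
  | prop (x : Var) (v : Val)
  | null

/-- Entries of the local state of a process. -/
inductive Entry (Var Val Intl Op : Type*)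
  | read (x : Var) (v : Val)
  | write (x : Var) (v : Val)
  | fence
  | rmw (x : Var) (vexp vnew : Val)
  | intl (a : Intl)
  | invoke (o : Op)

/-- A local state is the list of the observations of a process so far. -/
abbrev LocalState (Var Val Intl Op : Type*) : Type _ := List (Entry Var Val Intl Op)

/-- A basic TSO state: the main memory and a store buffer for every process
(oldest item first). -/
@[ext]
structure MemState (n : ℕ) (Var Val : Type*) where
  mem : Var → Val
  buf : Fin n → List (Var × Val)

/-- A global state: a basic TSO state and a local state for every process. -/
@[ext]
structure GlobalState (n : ℕ) (Var Val Intl Op : Type*) where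
  tso : MemState n Var Val
  loc : Fin n → LocalState Var Val Intl Op

/-- A joint action: an action for every agent and at most one invocation for every process. -/
structure JointAction (n : ℕ) (Var Val Intl Op : Type*) where
  act : Agent n → Action Var Val Intl
  invoke : Fin n → Option Op

namespace MemState

variable {n : ℕ} {Var Val Intl Op : Type*}

/-- The precondition of an action of an agent in a TSO state. -/
def Enabled (σ : MemState n Var Val) : Agent n → Action Var Val Intl → Prop
  | .proc _, .read _ => True
  | .proc _, .write _ _ => True
  | .proc i, .fence => σ.buf i = []
  | .proc i, .rmw x vexp _ => σ.buf i = [] ∧ σ.mem x = vexp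
  | .proc _, .intl _ => True
  | .proc _, .null => True
  | .proc _, .prop => False
  | .disp i, .prop => σ.buf i ≠ []
  | .disp _, .null => True
  | .disp _, _ => False

variable [DecidableEq Var]

/-- The value of the latest item for `x` in the buffer of `i`, if there is one. -/
def bufValue (σ : MemState n Var Val) (i : Fin n) (x : Var) : Option Val :=
  (((σ.buf i).filter (fun p => p.1 = x)).getLast?).map Prod.snd

/-- The event that results when an agent performs an action in a TSO state. -/
def event (σ : MemState n Var Val) : Agent n → Action Var Val Intl → Event Var Val Intl
  | .proc i, .read x =>
      match σ.bufValue i x with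
      | some v => .rfb x v
      | none => .rfm x (σ.mem x)
  | .proc _, .write x v => .write x v
  | .proc _, .fence => .fence
  | .proc _, .rmw x vexp vnew => .rmw x vexp vnew
  | .proc _, .intl a => .intl a
  | .disp i, .prop =>
      match σ.buf i with
      | (x, v) :: _ => .prop x v
      | [] => .null
  | _, _ => .null

/-- The TSO state that results when an agent performs an action in a TSO state. -/
def perform (σ : MemState n Var Val) : Agent n → Action Var Val Intl → MemState n Var Val
  | .proc i, .write x v => ⟨σ.mem, Function.update σ.buf i (σ.buf i ++ [(x, v)])⟩
  | .proc _, .rmw x _ vnew => ⟨Function.update σ.mem x vnew, σ.buf⟩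
  | .disp i, .prop =>
      match σ.buf i with
      | (x, v) :: β => ⟨Function.update σ.mem x v, Function.update σ.buf i β⟩
      | [] => σ
  | _, _ => σ

/-- Perform the actions of the listed agents one by one. -/
def performList (σ : MemState n Var Val) (a : Agent n → Action Var Val Intl)
    (l : List (Agent n)) : MemState n Var Val :=
  l.foldl (fun τ b => τ.perform b (a b)) σ

end MemState

/-- The order in which the actions of a joint action take effect within a round: the dispatchers
`d_1, …, d_n`, then the processes `1, …, n`. (The invocations, which do not touch the TSO state,
come last.) -/
def agentOrder (n : ℕ) : List (Agent n) :=
  (List.finRange n).map Agent.disp ++ (List.finRange n).map Agent.proc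

namespace MemState

variable {n : ℕ} {Var Val Intl Op : Type*} [DecidableEq Var]

/-- The TSO state after a whole joint action. -/
def next (σ : MemState n Var Val) (a : Agent n → Action Var Val Intl) : MemState n Var Val :=
  σ.performList a (agentOrder n)

/-- The TSO state in which the action of `b` takes effect, within a joint action. -/
def before (σ : MemState n Var Val) (a : Agent n → Action Var Val Intl) (b : Agent n) :
    MemState n Var Val :=
  σ.performList a ((agentOrder n).takeWhile (fun c => c ≠ b))

/-- The event at the agent `b` when a joint action takes place. -/
def jointEvent (σ : MemState n Var Val) (a : Agent n → Action Var Val Intl) (b : Agent n) :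
    Event Var Val Intl :=
  (σ.before a b).event b (a b)

end MemState

namespace Event

variable {Var Val Intl : Type*}

/-- What a process records of an event in its local state. It does not observe whether a read is
from its buffer or from memory, and null actions leave no record. -/
def entries (Op : Type*) : Event Var Val Intl → List (Entry Var Val Intl Op)
  | .rfb x v => [.read x v]
  | .rfm x v => [.read x v]
  | .write x v => [.write x v]
  | .fence => [.fence]
  | .rmw x vexp vnew => [.rmw x vexp vnew]
  | .intl a => [.intl a]
  | .prop _ _ => []
  | .null => []

def IsRfM (e : Event Var Val Intl) : Prop := ∃ x v, e = .rfm x v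
def IsRfB (e : Event Var Val Intl) : Prop := ∃ x v, e = .rfb x v
def IsWrite (e : Event Var Val Intl) : Prop := ∃ x v, e = .write x v
def IsProp (e : Event Var Val Intl) : Prop := ∃ x v, e = .prop x v
def IsRMW (e : Event Var Val Intl) : Prop := ∃ x v w, e = .rmw x v w

/-- Events that change the variable `x` in memory. -/
def ChangesMem (e : Event Var Val Intl) (x : Var) : Prop :=
  (∃ v w, e = .rmw x v w) ∨ (∃ v, e = .prop x v)

/-- Memory accesses of the variable `x`. -/
def Accesses (e : Event Var Val Intl) (x : Var) : Prop :=
  (∃ v w, e = .rmw x v w) ∨ (∃ v, e = .prop x v) ∨ (∃ v, e = .rfm x v)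

end Event

/-- `b` is the dispatcher of the process `c`, `b` propagates, and `c` reads from memory. -/
def PropRfM {n : ℕ} {Var Val Intl : Type*} (b : Agent n) (e : Event Var Val Intl)
    (c : Agent n) (f : Event Var Val Intl) : Prop :=
  ∃ i, b = .disp i ∧ c = .proc i ∧ e.IsProp ∧ f.IsRfM

/-- The events `e` at `b` and `f` at `c` are conflicting. -/
def Conflicting {n : ℕ} {Var Val Intl : Type*} (b : Agent n) (e : Event Var Val Intl)
    (c : Agent n) (f : Event Var Val Intl) : Prop :=
  ¬ (e.IsRfM ∧ f.IsRfM) ∧ (∃ x, e.Accesses x ∧ f.Accesses x) ∧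
    ¬ (PropRfM b e c f ∨ PropRfM c f b e)

/-- A TSO run, with time `ℕ`: the global state at every time `t`, and the joint action that takes
place at time `t` (in round `t + 1`) and leads from the state at `t` to the state at `t + 1`.
The memory is arbitrary initially. -/
structure Run (n : ℕ) (Var Val Intl Op : Type*) [DecidableEq Var] where
  state : ℕ → GlobalState n Var Val Intl Op
  joint : ℕ → JointAction n Var Val Intl Op
  buf_zero : ∀ i, (state 0).tso.buf i = []
  loc_zero : ∀ i, (state 0).loc i = []
  enabled : ∀ t b, (state t).tso.Enabled b ((joint t).act b)
  nonconflicting : ∀ t b c, b ≠ c →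
    ¬ Conflicting b ((state t).tso.jointEvent (joint t).act b)
      c ((state t).tso.jointEvent (joint t).act c)
  tso_succ : ∀ t, (state (t + 1)).tso = (state t).tso.next (joint t).act
  loc_succ : ∀ t i, (state (t + 1)).loc i =
    (state t).loc i
      ++ ((state t).tso.jointEvent (joint t).act (.proc i)).entries Op
      ++ (((joint t).invoke i).map Entry.invoke).toList

/-- A (nondeterministic) protocol assigns to every local state of every process a nonempty set of
process actions. -/
structure Protocol (n : ℕ) (Var Val Intl Op : Type*) where
  acts : Fin n → LocalState Var Val Intl Op → Set (Action Var Val Intl)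
  nonempty : ∀ i ℓ, (acts i ℓ).Nonempty
  not_prop : ∀ i ℓ, Action.prop ∉ acts i ℓ

namespace Run

variable {n : ℕ} {Var Val Intl Op : Type*} [DecidableEq Var]

/-- The action of the agent `b` at time `t`. -/
def action (r : Run n Var Val Intl Op) (b : Agent n) (t : ℕ) : Action Var Val Intl :=
  (r.joint t).act b

/-- The event at the node `⟨b, t⟩`. -/
def event (r : Run n Var Val Intl Op) (b : Agent n) (t : ℕ) : Event Var Val Intl :=
  (r.state t).tso.jointEvent (r.joint t).act b

/-- The local state of the process `i` at time `t`. -/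
def loc (r : Run n Var Val Intl Op) (i : Fin n) (t : ℕ) : LocalState Var Val Intl Op :=
  (r.state t).loc i

/-- `r` is a run of the protocol `P`. -/
def IsRunOf (r : Run n Var Val Intl Op) (P : Protocol n Var Val Intl Op) : Prop :=
  ∀ t i, r.action (.proc i) t ≠ .null → r.action (.proc i) t ∈ P.acts i (r.loc i t)

/-- The number of writes of `i` at times `≤ t`. -/
noncomputable def writeCount (r : Run n Var Val Intl Op) (i : Fin n) (t : ℕ) : ℕ :=
  {s | s ≤ t ∧ (r.event (.proc i) s).IsWrite}.ncard

/-- The number of propagations by `d_i` at times `≤ t`. -/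
noncomputable def propCount (r : Run n Var Val Intl Op) (i : Fin n) (t : ℕ) : ℕ :=
  {s | s ≤ t ∧ (r.event (.disp i) s).IsProp}.ncard

/-- `r.HasTag b t κ`: the event at `⟨b, t⟩` has the tag `κ`, i.e. it writes, propagates or reads
the item named by `κ`. Buffers are first-in-first-out queues, so the `k`-th propagation by `d_i`
propagates the item of the `k`-th write of `i`; a read of `x` from the buffer reads the item of the
latest write to `x` by the process; a read of `x` from memory reads the item propagated last to
`x`, unless `x` has been changed by a read-modify-write since. Values of `x` that stem from
the initial memory or from a read-modify-write have no tag. Within a round propagations precede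
reads, so the propagation may be in the same round as the read from memory. -/
inductive HasTag (r : Run n Var Val Intl Op) : Agent n → ℕ → Tag n → Prop
  | write (i : Fin n) (t : ℕ) (h : (r.event (.proc i) t).IsWrite) :
      HasTag r (.proc i) t (i, r.writeCount i t)
  | prop (i : Fin n) (t : ℕ) (h : (r.event (.disp i) t).IsProp) :
      HasTag r (.disp i) t (i, r.propCount i t)
  | rfb (i : Fin n) (s t : ℕ) (x : Var) (v w : Val) (h : r.event (.proc i) t = .rfb x v)
      (hst : s < t) (hs : r.event (.proc i) s = .write x w)
      (hlast : ∀ u, s < u → u < t → ∀ w', r.event (.proc i) u ≠ .write x w') :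
      HasTag r (.proc i) t (i, r.writeCount i s)
  | rfm (i j : Fin n) (s t : ℕ) (x : Var) (v w : Val) (h : r.event (.proc i) t = .rfm x v)
      (hst : s ≤ t) (hs : r.event (.disp j) s = .prop x w)
      (hlast : ∀ u, s < u → u ≤ t → ∀ c, ¬ (r.event c u).ChangesMem x) :
      HasTag r (.proc i) t (j, r.propCount j s)

/-- The occurs-before relation between the nodes of a run. -/
inductive OccursBefore (r : Run n Var Val Intl Op) : Node n → Node n → Prop
  | locality (b : Agent n) (t t' : ℕ) (ht : t < t') : OccursBefore r (b, t) (b, t')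
  | buffer (i : Fin n) (t t' : ℕ) (ht : t < t') (κ : Tag n)
      (h : (r.event (.proc i) t).IsWrite ∨ (r.event (.proc i) t).IsRfB)
      (h' : (r.event (.disp i) t').IsProp)
      (hκ : r.HasTag (.proc i) t κ) (hκ' : r.HasTag (.disp i) t' κ) :
      OccursBefore r (.proc i, t) (.disp i, t')
  | access (b c : Agent n) (t t' : ℕ) (ht : t < t') (x : Var)
      (h : (r.event b t).Accesses x) (h' : (r.event c t').Accesses x)
      (hR : ¬ ((r.event b t).IsRfM ∧ (r.event c t').IsRfM))
      (hP : ¬ PropRfM b (r.event b t) c (r.event c t')) :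
      OccursBefore r (b, t) (c, t')
  | fence (i : Fin n) (t t' : ℕ) (ht : t < t') (h : (r.event (.disp i) t).IsProp)
      (h' : r.event (.proc i) t' = .fence ∨ (r.event (.proc i) t').IsRMW) :
      OccursBefore r (.disp i, t) (.proc i, t')
  | trans (θ θ' θ'' : Node n) (h : OccursBefore r θ θ') (h' : OccursBefore r θ' θ'') :
      OccursBefore r θ θ''

/-- The past of a set of nodes. -/
def Past (r : Run n Var Val Intl Op) (S : Set (Node n)) : Set (Node n) :=
  {θ | ∃ θ' ∈ S, r.OccursBefore θ θ'}

def PastPlus (r : Run n Var Val Intl Op) (S : Set (Node n)) : Set (Node n) :=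
  r.Past S ∪ S

/-- Local equivalence: every process passes through the same local states in both runs. -/
def LocallyEquivalent (r r' : Run n Var Val Intl Op) : Prop :=
  ∀ j ℓ, (∃ t, r.loc j t = ℓ) ↔ (∃ t, r'.loc j t = ℓ)

open Classical in
/-- The time to which an action of `b` at time `t` is moved: it is kept if `⟨b, t⟩` is in the past
of `S`, and delayed by `Δ` otherwise. -/
noncomputable def newTime (r : Run n Var Val Intl Op) (S : Set (Node n)) (Δ : ℕ) (b : Agent n)
    (t : ℕ) : ℕ :=
  if (b, t) ∈ r.Past S then t else t + Δ

end Run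

end TSO

/-!
Let `φ` move the action of `b` at time `t` to time `φ b t`. All that the occurs-before relation is
needed for is that `φ` is strictly increasing along it; delaying everything outside the past of `S`
is such a retiming, because every node that occurs before a node of the past is in the past as well.

Buffers are first-in-first-out, so the buffer of `i` is determined by the numbers of writes of `i`
and of propagations by `d_i` so far, and the `k`-th propagation is still one of the item of the
`k`-th write as long as it is performed after it. Reads from the buffer, fences and
read-modify-writes keep their order relative to the propagations that matter to them, so they see
the same items, or still an empty buffer. The changes of a variable in memory keep their order
too, and so do a read from memory and the changes by other agents. The only freedom is that a read
of `x` from memory by `i` can overtake earlier propagations to `x` by `d_i`. If it does, then it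
finds in the buffer the item of the latest write of `i` to `x`; no other agent can have changed `x`
between its propagation and the read, because that change would have to be moved between them as
well. So the read returns the same value with the same tag, now from the buffer. Finally, a process
that performs the same actions with the same results goes through the same local states.
-/

namespace TSO

theorem ncard_setOf_le_and (p : ℕ → Prop) [DecidablePred p] (t : ℕ) :
    {s | s ≤ t ∧ p s}.ncard = Nat.count p (t + 1) := by
  rw [Nat.count_eq_card_filter_range, ← Set.ncard_coe_finset]
  congr 1
  ext s
  simp

theorem exists_count_eq_of_lt_count {p : ℕ → Prop} {_ : DecidablePred p} {k t : ℕ}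
    (h : k < Nat.count p t) : ∃ s < t, p s ∧ Nat.count p s = k := by
  have hk : ∀ hp : {s | p s}.Finite, k < hp.toFinset.card := fun hp =>
    h.trans_le (Nat.count_le_card hp t)
  exact ⟨Nat.nth p k, Nat.nth_lt_of_lt_count h, Nat.nth_mem k hk, Nat.count_nth hk⟩

theorem count_lt_count_iff {p : ℕ → Prop} {_ : DecidablePred p} {s t : ℕ} (hs : p s) :
    Nat.count p s < Nat.count p t ↔ s < t :=
  ⟨(Nat.count_monotone p).reflect_lt, Nat.count_strict_mono hs⟩

/-- The number of steps that have taken place before time `u`, if step `t` takes place at time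
`f t`. -/
noncomputable def clock (f : ℕ → ℕ) (u : ℕ) : ℕ :=
  sInf {t | u ≤ f t}

section Clock

variable {f : ℕ → ℕ} (hf : StrictMono f)

include hf

theorem gc_clock : GaloisConnection (clock f) f := by
  intro u t
  refine ⟨fun h => ?_, fun h => Nat.sInf_le h⟩
  have hne : {t | u ≤ f t}.Nonempty := ⟨u, hf.le_apply⟩
  exact (Nat.sInf_mem hne).trans (hf.monotone h)

theorem lt_clock_iff {t u : ℕ} : t < clock f u ↔ f t < u :=
  (gc_clock hf).lt_iff_lt

theorem clock_zero : clock f 0 = 0 :=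
  (gc_clock hf).l_bot

theorem clock_apply (t : ℕ) : clock f (f t) = t :=
  hf.injective ((gc_clock hf).u_l_u_eq_u t)

theorem clock_apply_succ (t : ℕ) : clock f (f t + 1) = t + 1 :=
  eq_of_forall_lt_iff fun s => by
    rw [lt_clock_iff hf, Nat.lt_succ_iff, hf.le_iff_le, Nat.lt_succ_iff]

theorem clock_succ_of_notMem_range {u : ℕ} (hu : u ∉ Set.range f) :
    clock f (u + 1) = clock f u :=
  eq_of_forall_lt_iff fun s => by
    have : f s ≠ u := fun h => hu ⟨s, h⟩
    rw [lt_clock_iff hf, lt_clock_iff hf]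
    omega

theorem count_eq_count_clock {p q : ℕ → Prop} {_ : DecidablePred p} {_ : DecidablePred q}
    (hq : ∀ u, q u ↔ ∃ t, f t = u ∧ p t) (u : ℕ) :
    Nat.count q u = Nat.count p (clock f u) := by
  induction u with
  | zero => simp [clock_zero hf]
  | succ u ih =>
    by_cases hu : u ∈ Set.range f
    · obtain ⟨t, rfl⟩ := hu
      have hqt : q (f t) ↔ p t := by simp [hq, hf.injective.eq_iff]
      rw [clock_apply hf] at ih
      simp only [Nat.count_succ, clock_apply_succ hf, ih, hqt]
    · have hqu : ¬ q u := fun h => hu (((hq u).1 h).imp fun _ => And.left)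
      rw [Nat.count_succ, if_neg hqu, clock_succ_of_notMem_range hf hu, ih, add_zero]

end Clock

/-! ### The effect of a joint action -/

theorem nodup_agentOrder (n : ℕ) : (agentOrder n).Nodup := by
  refine List.Nodup.append ?_ ?_ (by simp [List.Disjoint])
  · exact (List.nodup_finRange n).map fun _ _ => Agent.disp.inj
  · exact (List.nodup_finRange n).map fun _ _ => Agent.proc.inj

theorem mem_agentOrder {n : ℕ} (b : Agent n) : b ∈ agentOrder n := by
  cases b <;> simp [agentOrder]

theorem notMem_of_agentOrder_eq {n : ℕ} {b : Agent n} {l₁ l₂ : List (Agent n)}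
    (h : agentOrder n = l₁ ++ b :: l₂) : b ∉ l₁ ∧ b ∉ l₂ := by
  have hnd := nodup_agentOrder n
  rw [h, List.nodup_middle, List.nodup_cons, List.mem_append, not_or] at hnd
  exact hnd.1

theorem exists_agentOrder_eq {n : ℕ} (i : Fin n) :
    ∃ l₁ l₂ : List (Fin n), i ∉ l₁ ∧ i ∉ l₂ ∧
      agentOrder n = l₁.map .disp ++ .disp i ::
        (l₂.map .disp ++ l₁.map .proc ++ .proc i :: l₂.map .proc) := by
  obtain ⟨l₁, l₂, hl⟩ := List.append_of_mem (List.mem_finRange i)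
  have hnd := List.nodup_finRange n
  rw [hl, List.nodup_middle, List.nodup_cons, List.mem_append, not_or] at hnd
  exact ⟨l₁, l₂, hnd.1.1, hnd.1.2, by simp [agentOrder, hl]⟩

/-- The items that an action of a process appends to its buffer. -/
def Action.items {Var Val Intl : Type*} : Action Var Val Intl → List (Var × Val)
  | .write x v => [(x, v)]
  | _ => []

namespace Event

variable {Var Val Intl : Type*} {e : Event Var Val Intl} {x : Var} {v : Val}

/-- The memory variable that an event changes and its new value, if there is one. -/
def assignment : Event Var Val Intl → Option (Var × Val)
  | .rmw x _ w => some (x, w)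
  | .prop x v => some (x, v)
  | _ => none

/-- The memory that results from the memory `m` by an event. -/
def updateMem [DecidableEq Var] (e : Event Var Val Intl) (m : Var → Val) : Var → Val :=
  match e.assignment with
  | some (x, v) => Function.update m x v
  | none => m

theorem changesMem_iff : e.ChangesMem x ↔ ∃ v, e.assignment = some (x, v) := by
  cases e <;> simp [ChangesMem, assignment]

theorem ChangesMem.accesses (h : e.ChangesMem x) : e.Accesses x :=
  h.imp_right .inl

theorem ChangesMem.not_isRfM (h : e.ChangesMem x) : ¬ e.IsRfM := by
  rintro ⟨y, w, rfl⟩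
  simp [ChangesMem] at h

theorem updateMem_of_assignment_eq [DecidableEq Var] (h : e.assignment = some (x, v))
    (m : Var → Val) : e.updateMem m x = v := by
  simp [updateMem, h]

theorem updateMem_of_not_changesMem [DecidableEq Var] (h : ¬ e.ChangesMem x) (m : Var → Val) :
    e.updateMem m x = m x := by
  rw [changesMem_iff, not_exists] at h
  rcases he : e.assignment with _ | ⟨y, w⟩
  · simp only [updateMem, he]
  · simp only [updateMem, he]
    exact Function.update_of_ne (fun hxy : x = y => h w (hxy ▸ he)) _ _

theorem foldl_updateMem_of_not_changesMem [DecidableEq Var] {ι : Type*}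
    {f : ι → Event Var Val Intl} {l : List ι} (h : ∀ b ∈ l, ¬ (f b).ChangesMem x) (m : Var → Val) :
    l.foldl (fun m b => (f b).updateMem m) m x = m x := by
  induction l generalizing m with
  | nil => rfl
  | cons b l ih =>
    rw [List.forall_mem_cons] at h
    rw [List.foldl_cons, ih h.2, updateMem_of_not_changesMem h.1]

end Event

namespace MemState

variable {n : ℕ} {Var Val Intl : Type*}

theorem enabled_null (σ : MemState n Var Val) (b : Agent n) :
    σ.Enabled b (.null : Action Var Val Intl) := by
  cases b <;> trivial

variable [DecidableEq Var] (σ : MemState n Var Val) (a : Agent n → Action Var Val Intl)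

open Classical in
theorem perform_disp_buf (i : Fin n) (α : Action Var Val Intl) :
    (σ.perform (.disp i) α).buf i = (σ.buf i).drop (if α = .prop then 1 else 0) := by
  cases α <;> simp only [perform, reduceCtorEq, if_true, if_false, List.drop_zero]
  cases h : σ.buf i <;> simp [h]

theorem perform_proc_buf (i : Fin n) (α : Action Var Val Intl) :
    (σ.perform (.proc i) α).buf i = σ.buf i ++ α.items := by
  cases α <;> simp [perform, Action.items]

theorem perform_buf_of_ne {i : Fin n} {b : Agent n} (hd : b ≠ .disp i) (hp : b ≠ .proc i)
    (α : Action Var Val Intl) : (σ.perform b α).buf i = σ.buf i := by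
  rcases b with j | j <;> cases α <;> simp only [perform]
  · exact Function.update_of_ne (fun h : i = j => hp (congrArg Agent.proc h.symm)) _ _
  · cases σ.buf j
    · rfl
    · exact Function.update_of_ne (fun h : i = j => hd (congrArg Agent.disp h.symm)) _ _

theorem perform_mem (b : Agent n) (α : Action Var Val Intl) :
    (σ.perform b α).mem = (σ.event b α).updateMem σ.mem := by
  rcases b with i | i <;> cases α <;> try rfl
  · simp only [perform, event]
    split <;> rfl
  · simp only [perform, event]
    cases σ.buf i <;> rfl

theorem performList_append (l₁ l₂ : List (Agent n)) :
    σ.performList a (l₁ ++ l₂) = (σ.performList a l₁).performList a l₂ :=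
  List.foldl_append

theorem performList_cons (b : Agent n) (l : List (Agent n)) :
    σ.performList a (b :: l) = (σ.perform b (a b)).performList a l := rfl

theorem performList_buf_of_notMem {i : Fin n} {l : List (Agent n)} (hd : .disp i ∉ l)
    (hp : .proc i ∉ l) : (σ.performList a l).buf i = σ.buf i := by
  induction l generalizing σ with
  | nil => rfl
  | cons b l ih =>
    rw [List.mem_cons, not_or] at hd hp
    rw [performList_cons, ih _ hd.2 hp.2, perform_buf_of_ne σ (Ne.symm hd.1) (Ne.symm hp.1)]

theorem before_eq {b : Agent n} {l₁ l₂ : List (Agent n)} (h : agentOrder n = l₁ ++ b :: l₂) :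
    σ.before a b = σ.performList a l₁ := by
  have hne : ∀ c ∈ l₁, decide (c ≠ b) = true := fun c hc =>
    decide_eq_true fun hcb => (notMem_of_agentOrder_eq h).1 (hcb ▸ hc)
  rw [before, h, List.takeWhile_append_of_pos hne, List.takeWhile_cons_of_neg (by simp),
    List.append_nil]

theorem before_disp_buf (i : Fin n) : (σ.before a (.disp i)).buf i = σ.buf i := by
  obtain ⟨l₁, l₂, h₁, -, hl⟩ := exists_agentOrder_eq i
  rw [before_eq σ a hl, performList_buf_of_notMem] <;> simp [h₁]

open Classical in
theorem before_proc_buf (i : Fin n) :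
    (σ.before a (.proc i)).buf i =
      (σ.buf i).drop (if a (.disp i) = .prop then 1 else 0) := by
  obtain ⟨l₁, l₂, h₁, h₂, hl⟩ := exists_agentOrder_eq i
  rw [← List.cons_append, ← List.append_assoc] at hl
  rw [before_eq σ a hl, performList_append, performList_cons, performList_buf_of_notMem,
    perform_disp_buf, performList_buf_of_notMem] <;> simp [h₁, h₂]

open Classical in
theorem next_buf (i : Fin n) :
    (σ.next a).buf i =
      (σ.buf i).drop (if a (.disp i) = .prop then 1 else 0) ++ (a (.proc i)).items := by
  obtain ⟨l₁, l₂, -, h₂, hl⟩ := exists_agentOrder_eq i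
  rw [← List.cons_append, ← List.append_assoc] at hl
  rw [next, hl, performList_append, performList_cons, performList_buf_of_notMem,
    perform_proc_buf, ← before_eq σ a hl, before_proc_buf] <;> simp [h₂]

theorem performList_mem {l₁ l₂ : List (Agent n)} (h : agentOrder n = l₁ ++ l₂) :
    (σ.performList a l₁).mem =
      l₁.foldl (fun m b => (σ.jointEvent a b).updateMem m) σ.mem := by
  induction l₁ using List.reverseRecOn generalizing l₂ with
  | nil => rfl
  | append_singleton l b ih =>
    rw [List.append_assoc, List.singleton_append] at h
    rw [performList_append, performList_cons, List.foldl_append, ← ih h, List.foldl_cons,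
      List.foldl_nil, jointEvent, before_eq σ a h]
    exact perform_mem _ _ _

variable {σ a} {x : Var} {v : Val} {i : Fin n}

theorem next_mem_of_not_changesMem (h : ∀ b, ¬ (σ.jointEvent a b).ChangesMem x) :
    (σ.next a).mem x = σ.mem x := by
  rw [next, performList_mem σ a (List.append_nil _).symm]
  exact Event.foldl_updateMem_of_not_changesMem (fun b _ => h b) _

theorem next_mem_of_assignment_eq {b : Agent n}
    (hb : (σ.jointEvent a b).assignment = some (x, v))
    (h : ∀ c, (σ.jointEvent a c).ChangesMem x → c = b) : (σ.next a).mem x = v := by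
  obtain ⟨l₁, l₂, hl⟩ := List.append_of_mem (mem_agentOrder b)
  have hl₂ : ∀ c ∈ l₂, ¬ (σ.jointEvent a c).ChangesMem x := fun c hc hx =>
    (notMem_of_agentOrder_eq hl).2 (h c hx ▸ hc)
  rw [next, performList_mem σ a (List.append_nil _).symm, hl, List.foldl_append, List.foldl_cons,
    Event.foldl_updateMem_of_not_changesMem hl₂, Event.updateMem_of_assignment_eq hb]

theorem before_proc_mem (h : ∀ j, ¬ (σ.jointEvent a (.proc j)).ChangesMem x) :
    (σ.before a (.proc i)).mem x = (σ.next a).mem x := by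
  obtain ⟨l₁, l₂, -, -, hl⟩ := exists_agentOrder_eq i
  rw [← List.cons_append, ← List.append_assoc] at hl
  generalize List.map _ _ ++ _ :: (_ ++ _) = l at hl
  rw [before_eq σ a hl, performList_mem σ a hl, next,
    performList_mem σ a (List.append_nil _).symm, hl, List.foldl_append]
  symm
  apply Event.foldl_updateMem_of_not_changesMem
  intro b hb
  obtain ⟨j, rfl⟩ : ∃ j, b = .proc j := by
    rcases List.mem_cons.1 hb with rfl | hb
    · exact ⟨i, rfl⟩
    · exact (List.mem_map.1 hb).imp fun j hj => hj.2.symm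
  exact h j

theorem jointEvent_disp_eq_prop_iff :
    σ.jointEvent a (.disp i) = .prop x v ↔
      a (.disp i) = .prop ∧ (σ.buf i).head? = some (x, v) := by
  have hb := before_disp_buf σ a i
  rw [jointEvent]
  cases a (.disp i) <;> simp only [event, hb, reduceCtorEq, false_and, true_and]
  cases σ.buf i <;> simp [Prod.ext_iff]

theorem jointEvent_disp_of_ne_prop (h : a (.disp i) ≠ .prop) :
    σ.jointEvent a (.disp i) = .null := by
  rw [jointEvent]
  cases ha : a (.disp i) <;> first | rfl | exact absurd ha h

theorem jointEvent_of_null {b : Agent n} (h : a b = .null) : σ.jointEvent a b = .null := by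
  rw [jointEvent, h]
  cases b <;> rfl

theorem jointEvent_proc_of_not_read {τ : MemState n Var Val} {a' : Agent n → Action Var Val Intl}
    (h : a (.proc i) = a' (.proc i)) (hr : ∀ x, a (.proc i) ≠ .read x) :
    σ.jointEvent a (.proc i) = τ.jointEvent a' (.proc i) := by
  rw [jointEvent, jointEvent, ← h]
  cases ha : a (.proc i) <;> first | rfl | exact absurd ha (hr _)

theorem jointEvent_of_read (h : a (.proc i) = .read x) :
    (∃ v, σ.jointEvent a (.proc i) = .rfb x v) ∨ ∃ v, σ.jointEvent a (.proc i) = .rfm x v := by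
  rw [jointEvent, h, event]
  split
  exacts [.inl ⟨_, rfl⟩, .inr ⟨_, rfl⟩]

theorem assignment_jointEvent_disp_eq_some_iff :
    (σ.jointEvent a (.disp i)).assignment = some (x, v) ↔
      σ.jointEvent a (.disp i) = .prop x v := by
  rw [jointEvent]
  cases a (.disp i) <;> simp only [event]
  case prop => split <;> simp [Event.assignment]
  all_goals simp [Event.assignment]

theorem jointEvent_eq_rfb_iff :
    σ.jointEvent a (.proc i) = .rfb x v ↔
      a (.proc i) = .read x ∧ (σ.before a (.proc i)).bufValue i x = some v := by
  rw [jointEvent]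
  cases a (.proc i) <;> simp only [event, reduceCtorEq, false_and]
  split <;> grind

theorem jointEvent_eq_rfm_iff :
    σ.jointEvent a (.proc i) = .rfm x v ↔
      a (.proc i) = .read x ∧ (σ.before a (.proc i)).bufValue i x = none ∧
        (σ.before a (.proc i)).mem x = v := by
  rw [jointEvent]
  cases a (.proc i) <;> simp only [event, reduceCtorEq, false_and]
  split <;> grind

theorem jointEvent_eq_write_iff :
    σ.jointEvent a (.proc i) = .write x v ↔ a (.proc i) = .write x v := by
  rw [jointEvent]
  cases a (.proc i) <;> simp only [event, reduceCtorEq, Event.write.injEq, Action.write.injEq]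
  split <;> simp

theorem jointEvent_eq_fence_iff :
    σ.jointEvent a (.proc i) = .fence ↔ a (.proc i) = .fence := by
  rw [jointEvent]
  cases a (.proc i) <;> simp only [event, reduceCtorEq]
  split <;> simp

theorem jointEvent_eq_rmw_iff {w : Val} :
    σ.jointEvent a (.proc i) = .rmw x v w ↔ a (.proc i) = .rmw x v w := by
  rw [jointEvent]
  cases a (.proc i) <;> simp only [event, reduceCtorEq, Event.rmw.injEq, Action.rmw.injEq]
  split <;> simp

end MemState

/-! ### Buffers and memory in terms of the actions performed -/

/-- A sequence of joint actions that starts with empty buffers, with the TSO states it produces.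
Unlike in a run, the actions need not be enabled and the events of a round may conflict. -/
structure Execution (n : ℕ) (Var Val Intl : Type*) [DecidableEq Var] where
  state : ℕ → MemState n Var Val
  act : ℕ → Agent n → Action Var Val Intl
  buf_zero : ∀ i, (state 0).buf i = []
  state_succ : ∀ t, state (t + 1) = (state t).next (act t)

namespace Execution

variable {n : ℕ} {Var Val Intl : Type*} [DecidableEq Var] (e : Execution n Var Val Intl)

/-- The event at the node `⟨b, t⟩`. -/
def event (b : Agent n) (t : ℕ) : Event Var Val Intl :=
  (e.state t).jointEvent (e.act t) b

/-- The items written by the process `i` before time `t`. -/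
def written (i : Fin n) (t : ℕ) : List (Var × Val) :=
  (List.range t).flatMap fun s => (e.act s (.proc i)).items

open Classical in
/-- The number of writes of `i` before time `t`. The write at time `s` is thus write number
`writesBefore i s` of `i`, counted from `0`, and has the tag `⟨i, writesBefore i s + 1⟩`. -/
noncomputable def writesBefore (i : Fin n) (t : ℕ) : ℕ :=
  Nat.count (fun s => (e.event (.proc i) s).IsWrite) t

open Classical in
/-- The number of times `d_i` has performed `prop` before time `t`. -/
noncomputable def propsBefore (i : Fin n) (t : ℕ) : ℕ :=
  Nat.count (fun s => e.act s (.disp i) = .prop) t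

/-- Every item has been written in an earlier round than it is propagated. -/
def Causal : Prop :=
  ∀ i t, e.propsBefore i (t + 1) ≤ e.writesBefore i t

/-- The latest write of `i` to `x` before time `t` takes place at time `s` and has the value `v`. -/
structure IsLatestWrite (i : Fin n) (x : Var) (v : Val) (s t : ℕ) : Prop where
  lt : s < t
  event_eq : e.event (.proc i) s = .write x v
  event_ne : ∀ u, s < u → u < t → ∀ w, e.event (.proc i) u ≠ .write x w

/-- The latest change of `x` in memory before time `t` is made by `b` at time `s`, to the value
`v`. -/
structure IsLatestAssignment (x : Var) (v : Val) (b : Agent n) (s t : ℕ) : Prop where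
  lt : s < t
  assignment_eq : (e.event b s).assignment = some (x, v)
  not_changesMem : ∀ u, s < u → u < t → ∀ c, ¬ (e.event c u).ChangesMem x

variable {e} {i : Fin n} {b : Agent n} {x : Var} {v : Val} {s t : ℕ}

theorem event_eq_write_iff :
    e.event (.proc i) t = .write x v ↔ e.act t (.proc i) = .write x v :=
  MemState.jointEvent_eq_write_iff

theorem items_eq_of_write (h : e.event (.proc i) t = .write x v) :
    (e.act t (.proc i)).items = [(x, v)] := by
  rw [event_eq_write_iff.1 h, Action.items]

theorem items_eq_nil_of_not_isWrite (h : ¬ (e.event (.proc i) t).IsWrite) :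
    (e.act t (.proc i)).items = [] := by
  cases ha : e.act t (.proc i) <;> try rfl
  exact absurd ⟨_, _, event_eq_write_iff.2 ha⟩ h

theorem propsBefore_succ_of_prop (h : e.act t (.disp i) = .prop) :
    e.propsBefore i (t + 1) = e.propsBefore i t + 1 := by
  rw [propsBefore, Nat.count_succ, if_pos h, propsBefore]

theorem writesBefore_succ_of_write (h : e.event (.proc i) t = .write x v) :
    e.writesBefore i (t + 1) = e.writesBefore i t + 1 := by
  rw [writesBefore, Nat.count_succ, if_pos ⟨x, v, h⟩, writesBefore]

theorem writesBefore_mono (i : Fin n) : Monotone (e.writesBefore i) := by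
  classical exact Nat.count_monotone _

theorem propsBefore_lt_iff (h : e.act s (.disp i) = .prop) :
    e.propsBefore i s < e.propsBefore i t ↔ s < t :=
  count_lt_count_iff h

theorem writesBefore_lt_iff (h : e.event (.proc i) s = .write x v) :
    e.writesBefore i s < e.writesBefore i t ↔ s < t :=
  count_lt_count_iff ⟨x, v, h⟩

theorem exists_prop_of_lt_propsBefore {k : ℕ} (h : k < e.propsBefore i t) :
    ∃ s < t, e.act s (.disp i) = .prop ∧ e.propsBefore i s = k :=
  exists_count_eq_of_lt_count h

theorem written_succ (i : Fin n) (t : ℕ) :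
    e.written i (t + 1) = e.written i t ++ (e.act t (.proc i)).items := by
  simp [written, List.range_succ]

theorem length_written (i : Fin n) (t : ℕ) : (e.written i t).length = e.writesBefore i t := by
  induction t with
  | zero => simp [written, writesBefore]
  | succ t ih =>
    rw [written_succ, List.length_append, ih, writesBefore, writesBefore, Nat.count_succ]
    split_ifs with h
    · obtain ⟨x, v, hw⟩ := h
      rw [items_eq_of_write hw, List.length_singleton]
    · rw [items_eq_nil_of_not_isWrite h, List.length_nil]

theorem written_getElem?_writesBefore (hs : e.event (.proc i) s = .write x v) (hst : s < t) :
    (e.written i t)[e.writesBefore i s]? = some (x, v) := by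
  induction t, hst using Nat.le_induction with
  | base => rw [written_succ, items_eq_of_write hs, ← length_written, List.getElem?_concat_length]
  | succ t hst ih => rw [written_succ, List.getElem?_append_left
      (List.getElem?_eq_some_iff.1 ih).1, ih]

theorem written_getElem?_eq_some_iff {k : ℕ} :
    (e.written i t)[k]? = some (x, v) ↔
      ∃ s < t, e.event (.proc i) s = .write x v ∧ e.writesBefore i s = k := by
  constructor
  · intro h
    have hk := (List.getElem?_eq_some_iff.1 h).1
    rw [length_written] at hk
    obtain ⟨s, hst, ⟨y, w, hs⟩, rfl⟩ := exists_count_eq_of_lt_count hk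
    have hxy := (written_getElem?_writesBefore hs hst).symm.trans h
    simp only [Option.some.injEq, Prod.mk.injEq] at hxy
    exact ⟨s, hst, by rw [hs, hxy.1, hxy.2], rfl⟩
  · rintro ⟨s, hst, hs, rfl⟩
    exact written_getElem?_writesBefore hs hst

theorem IsLatestWrite.time_eq {s' : ℕ} {v' : Val} (h : e.IsLatestWrite i x v s t)
    (h' : e.IsLatestWrite i x v' s' t) : s = s' := by
  rcases lt_trichotomy s s' with hlt | rfl | hlt
  exacts [absurd h'.event_eq (h.event_ne s' hlt h'.lt v'), rfl,
    absurd h.event_eq (h'.event_ne s hlt h.lt v)]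

theorem isLatestWrite_succ_iff :
    e.IsLatestWrite i x v s (t + 1) ↔
      s = t ∧ e.event (.proc i) t = .write x v ∨
        e.IsLatestWrite i x v s t ∧ ∀ w, e.event (.proc i) t ≠ .write x w := by
  constructor
  · rintro ⟨hlt, heq, hne⟩
    rcases Nat.lt_succ_iff_lt_or_eq.1 hlt with hst | rfl
    · exact .inr ⟨⟨hst, heq, fun u hsu hut => hne u hsu (by omega)⟩, hne t hst (by omega)⟩
    · exact .inl ⟨rfl, heq⟩
  · rintro (⟨rfl, heq⟩ | ⟨⟨hst, heq, hne⟩, ht⟩)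
    · exact ⟨by omega, heq, fun u hsu hus => by omega⟩
    · refine ⟨by omega, heq, fun u hsu hut => ?_⟩
      rcases Nat.lt_succ_iff_lt_or_eq.1 hut with hut | rfl
      · exact hne u hsu hut
      · exact ht

theorem exists_isLatestWrite (hs : e.event (.proc i) s = .write x v) (hst : s < t) :
    ∃ u w, s ≤ u ∧ e.IsLatestWrite i x w u t := by
  induction t, hst using Nat.le_induction with
  | base => exact ⟨s, v, le_rfl, isLatestWrite_succ_iff.2 (.inl ⟨rfl, hs⟩)⟩
  | succ t hst ih =>
    by_cases ht : ∃ w, e.event (.proc i) t = .write x w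
    · obtain ⟨w, hw⟩ := ht
      exact ⟨t, w, by omega, isLatestWrite_succ_iff.2 (.inl ⟨rfl, hw⟩)⟩
    · obtain ⟨u, w, hsu, hu⟩ := ih
      exact ⟨u, w, hsu, isLatestWrite_succ_iff.2 (.inr ⟨hu, not_exists.1 ht⟩)⟩

theorem getLast?_filter_drop_written_eq_some_iff {k : ℕ} :
    (((e.written i t).drop k).filter (fun p => p.1 = x)).getLast?.map Prod.snd = some v ↔
      ∃ s, e.IsLatestWrite i x v s t ∧ k ≤ e.writesBefore i s := by
  induction t with
  | zero => simpa [written] using fun s h => absurd h.lt (Nat.not_lt_zero s)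
  | succ t ih =>
    simp only [isLatestWrite_succ_iff, written_succ, List.drop_append, List.filter_append,
      length_written]
    by_cases ht : (e.event (.proc i) t).IsWrite
    · obtain ⟨y, w, hy⟩ := ht
      simp only [items_eq_of_write hy, hy, Event.write.injEq]
      by_cases hk : k ≤ e.writesBefore i t
      · by_cases hyx : y = x
        · simp [Nat.sub_eq_zero_of_le hk, hyx, hk]
        · simpa [Nat.sub_eq_zero_of_le hk, hyx, -List.getLast?_filter] using ih
      · have hnil : (e.written i t).drop k = [] := by
          rw [List.drop_eq_nil_iff, length_written]; omega
        have hnil' : [(y, w)].drop (k - e.writesBefore i t) = [] := by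
          rw [List.drop_eq_nil_iff, List.length_singleton]; omega
        have hlt : ∀ s, e.IsLatestWrite i x v s t → e.writesBefore i s < k := fun s hs =>
          ((writesBefore_lt_iff hs.event_eq).2 hs.lt).trans (not_le.1 hk)
        simp only [hnil, hnil', List.append_nil, List.filter_nil, List.getLast?_nil,
          Option.map_none, reduceCtorEq, false_iff, not_exists, not_and, not_le]
        rintro s (⟨rfl, -⟩ | ⟨hs, -⟩)
        exacts [not_le.1 hk, hlt s hs]
    · have hne : ∀ w, e.event (.proc i) t ≠ .write x w := fun w h => ht ⟨x, w, h⟩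
      simpa [items_eq_nil_of_not_isWrite ht, hne, -List.getLast?_filter] using ih

theorem buf_eq_of_forall_lt (h : ∀ s < t, e.propsBefore i (s + 1) ≤ e.writesBefore i s) :
    (e.state t).buf i = (e.written i t).drop (e.propsBefore i t) := by
  induction t with
  | zero => simp [e.buf_zero, written]
  | succ t ih =>
    have hle := h t t.lt_succ_self
    rw [propsBefore, Nat.count_succ, ← propsBefore, ← length_written] at hle
    rw [e.state_succ, MemState.next_buf, ih fun s hs => h s (hs.trans t.lt_succ_self),
      List.drop_drop, written_succ, ← List.drop_append_of_le_length hle, propsBefore, propsBefore,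
      Nat.count_succ]

theorem causal_of_buf_ne_nil (h : ∀ t i, e.act t (.disp i) = .prop → (e.state t).buf i ≠ []) :
    e.Causal := by
  intro i t
  induction t using Nat.strong_induction_on with
  | h t ih =>
    by_cases ht : e.act t (.disp i) = .prop
    · have hne := h t i ht
      rw [buf_eq_of_forall_lt ih, ne_eq, List.drop_eq_nil_iff, length_written, not_le] at hne
      rwa [propsBefore_succ_of_prop ht]
    · rw [propsBefore, Nat.count_succ, if_neg ht, ← propsBefore]
      cases t with
      | zero => simp [propsBefore]
      | succ t => exact (ih t t.lt_succ_self).trans (writesBefore_mono i t.le_succ)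

section Causal

variable (he : e.Causal)

include he

theorem Causal.buf_eq (i : Fin n) (t : ℕ) :
    (e.state t).buf i = (e.written i t).drop (e.propsBefore i t) :=
  buf_eq_of_forall_lt fun s _ => he i s

theorem Causal.buf_eq_nil_iff :
    (e.state t).buf i = [] ↔ e.writesBefore i t ≤ e.propsBefore i t := by
  rw [he.buf_eq, List.drop_eq_nil_iff, length_written]

theorem Causal.before_proc_buf (i : Fin n) (t : ℕ) :
    ((e.state t).before (e.act t) (.proc i)).buf i =
      (e.written i t).drop (e.propsBefore i (t + 1)) := by
  rw [MemState.before_proc_buf, he.buf_eq, List.drop_drop, propsBefore, propsBefore,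
    Nat.count_succ]

theorem Causal.event_eq_prop_iff :
    e.event (.disp i) t = .prop x v ↔ e.act t (.disp i) = .prop ∧
      ∃ s < t, e.event (.proc i) s = .write x v ∧ e.writesBefore i s = e.propsBefore i t := by
  rw [event, MemState.jointEvent_disp_eq_prop_iff, he.buf_eq, List.head?_drop,
    written_getElem?_eq_some_iff]

theorem Causal.bufValue_eq_some_iff :
    ((e.state t).before (e.act t) (.proc i)).bufValue i x = some v ↔
      ∃ s, e.IsLatestWrite i x v s t ∧ e.propsBefore i (t + 1) ≤ e.writesBefore i s := by
  rw [MemState.bufValue, he.before_proc_buf, getLast?_filter_drop_written_eq_some_iff]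

theorem Causal.event_eq_rfb_iff :
    e.event (.proc i) t = .rfb x v ↔ e.act t (.proc i) = .read x ∧
      ∃ s, e.IsLatestWrite i x v s t ∧ e.propsBefore i (t + 1) ≤ e.writesBefore i s := by
  rw [event, MemState.jointEvent_eq_rfb_iff, he.bufValue_eq_some_iff]

theorem Causal.event_eq_rfm_iff :
    e.event (.proc i) t = .rfm x v ↔ e.act t (.proc i) = .read x ∧
      (∀ s w, e.IsLatestWrite i x w s t → e.writesBefore i s < e.propsBefore i (t + 1)) ∧
      ((e.state t).before (e.act t) (.proc i)).mem x = v := by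
  rw [event, MemState.jointEvent_eq_rfm_iff, Option.eq_none_iff_forall_ne_some]
  simp only [ne_eq, he.bufValue_eq_some_iff, not_exists, not_and, not_le]
  grind

theorem Causal.exists_write_of_prop (h : e.act t (.disp i) = .prop) :
    ∃ s < t, ∃ x v, e.event (.proc i) s = .write x v ∧
      e.writesBefore i s = e.propsBefore i t := by
  have hle := he i t
  rw [propsBefore_succ_of_prop h] at hle
  obtain ⟨s, hst, ⟨x, v, hs⟩, hk⟩ := exists_count_eq_of_lt_count (Nat.lt_of_succ_le hle)
  exact ⟨s, hst, x, v, hs, hk⟩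

theorem Causal.isProp_iff :
    (e.event (.disp i) t).IsProp ↔ e.act t (.disp i) = .prop := by
  refine ⟨fun ⟨x, v, h⟩ => (he.event_eq_prop_iff.1 h).1, fun h => ?_⟩
  obtain ⟨s, hst, x, v, hs, hk⟩ := he.exists_write_of_prop h
  exact ⟨x, v, he.event_eq_prop_iff.2 ⟨h, s, hst, hs, hk⟩⟩

theorem Causal.lt_of_writesBefore_eq_propsBefore
    (hs : e.event (.proc i) s = .write x v) (ht : e.act t (.disp i) = .prop)
    (hk : e.writesBefore i s = e.propsBefore i t) : s < t := by
  rw [← writesBefore_lt_iff hs, hk, Nat.lt_iff_add_one_le, ← propsBefore_succ_of_prop ht]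
  exact he i t

theorem Causal.exists_write_of_changesMem_disp
    (h : (e.event (.disp i) t).ChangesMem x) :
    e.act t (.disp i) = .prop ∧ ∃ s < t, ∃ v, e.event (.proc i) s = .write x v ∧
      e.writesBefore i s = e.propsBefore i t := by
  have hact : e.act t (.disp i) = .prop := by
    by_contra hne
    rw [event, MemState.jointEvent_disp_of_ne_prop hne] at h
    simp [Event.ChangesMem] at h
  obtain ⟨y, v, hy⟩ := he.isProp_iff.2 hact
  rw [hy] at h
  obtain rfl : y = x := by simpa [Event.ChangesMem] using h
  obtain ⟨-, s, hst, hs, hk⟩ := he.event_eq_prop_iff.1 hy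
  exact ⟨hact, s, hst, v, hs, hk⟩

theorem Causal.not_changesMem_disp_of_isLatestWrite {w u : ℕ}
    (hw : e.IsLatestWrite i x v w t) (hs : e.act s (.disp i) = .prop)
    (hk : e.writesBefore i w = e.propsBefore i s) (hsu : s < u) (hut : u ≤ t) :
    ¬ (e.event (.disp i) u).ChangesMem x := by
  intro hu
  obtain ⟨-, w', hw'u, v', hw', hk'⟩ := he.exists_write_of_changesMem_disp hu
  have hww' : w < w' := by
    rwa [← writesBefore_lt_iff hw.event_eq, hk, hk', propsBefore_lt_iff hs]
  exact hw.event_ne w' hww' (hw'u.trans_le hut) v' hw'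

end Causal

theorem mem_succ_of_not_changesMem (h : ∀ c, ¬ (e.event c t).ChangesMem x) :
    (e.state (t + 1)).mem x = (e.state t).mem x := by
  rw [e.state_succ]
  exact MemState.next_mem_of_not_changesMem h

theorem mem_eq_mem_zero (h : ∀ s < t, ∀ c, ¬ (e.event c s).ChangesMem x) :
    (e.state t).mem x = (e.state 0).mem x := by
  induction t with
  | zero => rfl
  | succ t ih =>
    rw [mem_succ_of_not_changesMem (h t t.lt_succ_self)]
    exact ih fun s hs => h s (hs.trans t.lt_succ_self)

theorem IsLatestAssignment.mem_eq (h : e.IsLatestAssignment x v b s t)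
    (hu : ∀ c, (e.event c s).ChangesMem x → c = b) : (e.state t).mem x = v := by
  obtain ⟨hst, heq, hne⟩ := h
  induction t, hst using Nat.le_induction with
  | base =>
    rw [e.state_succ]
    exact MemState.next_mem_of_assignment_eq heq hu
  | succ t hst ih =>
    rw [mem_succ_of_not_changesMem (hne t hst t.lt_succ_self)]
    exact ih fun u hsu hut => hne u hsu (hut.trans t.lt_succ_self)

theorem mem_succ_of_rfm (h : e.event (.proc i) t = .rfm x v)
    (hproc : ∀ j, ¬ (e.event (.proc j) t).ChangesMem x) : (e.state (t + 1)).mem x = v := by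
  rw [e.state_succ, ← MemState.before_proc_mem hproc]
  exact (MemState.jointEvent_eq_rfm_iff.1 h).2.2

theorem IsLatestAssignment.changesMem (h : e.IsLatestAssignment x v b s t) :
    (e.event b s).ChangesMem x :=
  Event.changesMem_iff.2 ⟨v, h.assignment_eq⟩

theorem IsLatestAssignment.time_eq {s' : ℕ} {v' : Val} {c : Agent n}
    (h : e.IsLatestAssignment x v b s t) (h' : e.IsLatestAssignment x v' c s' t) : s = s' := by
  rcases lt_trichotomy s s' with hlt | rfl | hlt
  exacts [absurd h'.changesMem (h.not_changesMem s' hlt h'.lt c), rfl,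
    absurd h.changesMem (h'.not_changesMem s hlt h.lt b)]

theorem exists_isLatestAssignment_or (e : Execution n Var Val Intl) (x : Var) (t : ℕ) :
    (∃ v b s, e.IsLatestAssignment x v b s t) ∨ ∀ s < t, ∀ c, ¬ (e.event c s).ChangesMem x := by
  induction t with
  | zero => exact .inr fun s hs => absurd hs (Nat.not_lt_zero s)
  | succ t ih =>
    by_cases ht : ∃ b, (e.event b t).ChangesMem x
    · obtain ⟨b, hb⟩ := ht
      obtain ⟨v, hv⟩ := Event.changesMem_iff.1 hb
      exact .inl ⟨v, b, t, t.lt_succ_self, hv, fun u htu hut => by omega⟩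
    · rcases ih with ⟨v, b, s, hst, heq, hne⟩ | h
      · refine .inl ⟨v, b, s, hst.trans t.lt_succ_self, heq, fun u hsu hut => ?_⟩
        rcases Nat.lt_succ_iff_lt_or_eq.1 hut with hut | rfl
        exacts [hne u hsu hut, not_exists.1 ht]
      · refine .inr fun s hs => ?_
        rcases Nat.lt_succ_iff_lt_or_eq.1 hs with hs | rfl
        exacts [h s hs, not_exists.1 ht]

theorem assignment_event_proc_eq {e' : Execution n Var Val Intl} {u : ℕ}
    (h : e.act t (.proc i) = e'.act u (.proc i)) :
    (e.event (.proc i) t).assignment = (e'.event (.proc i) u).assignment := by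
  by_cases hr : ∃ x, e.act t (.proc i) = .read x
  · obtain ⟨x, hx⟩ := hr
    have assignment_eq_none : ∀ (f : Execution n Var Val Intl) (s : ℕ),
        f.act s (.proc i) = .read x → (f.event (.proc i) s).assignment = none := by
      intro f s hs
      rw [event, MemState.jointEvent, hs, MemState.event]
      split <;> rfl
    rw [assignment_eq_none e t hx, assignment_eq_none e' u (h ▸ hx)]
  · rw [event, event, MemState.jointEvent_proc_of_not_read h (not_exists.1 hr)]

/-! ### Moving the actions -/

/-- The execution in which the action of `b` at time `t` is moved to time `φ b t`. -/
noncomputable def reschedule (e : Execution n Var Val Intl) (φ : Agent n → ℕ → ℕ) :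
    Execution n Var Val Intl :=
  let act u b := Function.extend (φ b) (fun t => e.act t b) (fun _ => .null) u
  { state := Nat.rec (e.state 0) fun t σ => σ.next (act t)
    act
    buf_zero := e.buf_zero
    state_succ := fun _ => rfl }

section Reschedule

variable {φ : Agent n → ℕ → ℕ} {u : ℕ}

theorem act_reschedule_of_notMem (hu : u ∉ Set.range (φ b)) :
    (e.reschedule φ).act u b = .null :=
  Function.extend_apply' (fun t => e.act t b) (fun _ => .null) u hu

theorem event_reschedule_of_notMem (hu : u ∉ Set.range (φ b)) :
    (e.reschedule φ).event b u = .null :=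
  MemState.jointEvent_of_null (act_reschedule_of_notMem hu)

variable (hφ : ∀ b, StrictMono (φ b))

include hφ

theorem act_reschedule_apply (b : Agent n) (t : ℕ) :
    (e.reschedule φ).act (φ b t) b = e.act t b :=
  (hφ b).injective.extend_apply (fun t => e.act t b) (fun _ => .null) t

theorem act_reschedule_eq_iff {α : Action Var Val Intl} (hα : α ≠ .null) :
    (e.reschedule φ).act u b = α ↔ ∃ t, φ b t = u ∧ e.act t b = α := by
  constructor
  · intro h
    by_cases hu : u ∈ Set.range (φ b)
    · obtain ⟨t, rfl⟩ := hu
      exact ⟨t, rfl, by rwa [act_reschedule_apply hφ] at h⟩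
    · exact absurd ((act_reschedule_of_notMem hu).symm.trans h) hα.symm
  · rintro ⟨t, rfl, ht⟩
    rw [act_reschedule_apply hφ, ht]

theorem event_reschedule_eq_write_iff :
    (e.reschedule φ).event (.proc i) u = .write x v ↔
      ∃ t, φ (.proc i) t = u ∧ e.event (.proc i) t = .write x v := by
  simp only [event_eq_write_iff]
  exact act_reschedule_eq_iff hφ (by simp)

theorem writesBefore_reschedule (i : Fin n) (u : ℕ) :
    (e.reschedule φ).writesBefore i u = e.writesBefore i (clock (φ (.proc i)) u) := by
  refine count_eq_count_clock (hφ _) (fun u => ?_) u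
  simp only [Event.IsWrite, event_reschedule_eq_write_iff hφ]
  grind

theorem propsBefore_reschedule (i : Fin n) (u : ℕ) :
    (e.reschedule φ).propsBefore i u = e.propsBefore i (clock (φ (.disp i)) u) :=
  count_eq_count_clock (hφ _) (fun _ => act_reschedule_eq_iff hφ (by simp)) u

theorem writesBefore_reschedule_apply (i : Fin n) (t : ℕ) :
    (e.reschedule φ).writesBefore i (φ (.proc i) t) = e.writesBefore i t := by
  rw [writesBefore_reschedule hφ, clock_apply (hφ _)]

theorem propsBefore_reschedule_apply (i : Fin n) (t : ℕ) :
    (e.reschedule φ).propsBefore i (φ (.disp i) t) = e.propsBefore i t := by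
  rw [propsBefore_reschedule hφ, clock_apply (hφ _)]

theorem isLatestWrite_reschedule_iff :
    (e.reschedule φ).IsLatestWrite i x v u (φ (.proc i) t) ↔
      ∃ s, φ (.proc i) s = u ∧ e.IsLatestWrite i x v s t := by
  have hlt := fun s t => (hφ (.proc i)).lt_iff_lt (a := s) (b := t)
  constructor
  · rintro ⟨hut, hu, hne⟩
    obtain ⟨s, rfl, hs⟩ := (event_reschedule_eq_write_iff hφ).1 hu
    refine ⟨s, rfl, (hlt s t).1 hut, hs, fun s' hss' hs't w hw => ?_⟩
    exact hne _ ((hlt _ _).2 hss') ((hlt _ _).2 hs't) w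
      ((event_reschedule_eq_write_iff hφ).2 ⟨s', rfl, hw⟩)
  · rintro ⟨s, rfl, hst, hs, hne⟩
    refine ⟨(hlt s t).2 hst, (event_reschedule_eq_write_iff hφ).2 ⟨s, rfl, hs⟩,
      fun u hsu hut w hw => ?_⟩
    obtain ⟨s', rfl, hs'⟩ := (event_reschedule_eq_write_iff hφ).1 hw
    exact hne s' ((hlt _ _).1 hsu) ((hlt _ _).1 hut) w hs'

theorem causal_reschedule
    (h : ∀ i s t x v, e.event (.proc i) s = .write x v → e.act t (.disp i) = .prop →
      e.writesBefore i s = e.propsBefore i t → φ (.proc i) s < φ (.disp i) t)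
    (he : e.Causal) : (e.reschedule φ).Causal := by
  intro i u
  by_contra! hlt
  rw [propsBefore_reschedule hφ, writesBefore_reschedule hφ] at hlt
  obtain ⟨t, htu, ht, hk⟩ := exists_prop_of_lt_propsBefore hlt
  obtain ⟨s, -, x, v, hs, hst⟩ := he.exists_write_of_prop ht
  have hsu : s < clock (φ (.proc i)) u := by
    rw [lt_clock_iff (hφ _)]
    exact (h i s t x v hs ht hst).trans_le (Nat.lt_succ_iff.1 ((lt_clock_iff (hφ _)).1 htu))
  exact absurd (hst.trans hk) ((writesBefore_lt_iff hs).2 hsu).ne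

variable (he : e.Causal) (he' : (e.reschedule φ).Causal)

include he he'

theorem event_disp_reschedule_apply (i : Fin n) (t : ℕ) :
    (e.reschedule φ).event (.disp i) (φ (.disp i) t) = e.event (.disp i) t := by
  have hact := act_reschedule_apply (e := e) hφ (.disp i) t
  by_cases ht : e.act t (.disp i) = .prop
  · obtain ⟨s, hst, x, v, hs, hk⟩ := he.exists_write_of_prop ht
    rw [he.event_eq_prop_iff.2 ⟨ht, s, hst, hs, hk⟩, he'.event_eq_prop_iff]
    have hs' := (event_reschedule_eq_write_iff hφ).2 ⟨s, rfl, hs⟩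
    have hk' : (e.reschedule φ).writesBefore i (φ (.proc i) s) =
        (e.reschedule φ).propsBefore i (φ (.disp i) t) := by
      rw [writesBefore_reschedule_apply hφ, propsBefore_reschedule_apply hφ, hk]
    rw [← hact] at ht
    exact ⟨ht, _, he'.lt_of_writesBefore_eq_propsBefore hs' ht hk', hs', hk'⟩
  · rw [event, event, MemState.jointEvent_disp_of_ne_prop ht,
      MemState.jointEvent_disp_of_ne_prop (hact ▸ ht)]

theorem assignment_event_reschedule_eq_some_iff :
    ((e.reschedule φ).event b u).assignment = some (x, v) ↔
      ∃ t, φ b t = u ∧ (e.event b t).assignment = some (x, v) := by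
  have happly : ∀ t, ((e.reschedule φ).event b (φ b t)).assignment = (e.event b t).assignment := by
    intro t
    rcases b with i | i
    · exact assignment_event_proc_eq (act_reschedule_apply hφ _ t)
    · rw [event_disp_reschedule_apply hφ he he']
  by_cases hu : u ∈ Set.range (φ b)
  · obtain ⟨t, rfl⟩ := hu
    simp [happly, (hφ b).injective.eq_iff]
  · rw [event_reschedule_of_notMem hu]
    simp only [Event.assignment, reduceCtorEq, false_iff]
    exact fun ⟨t, ht, _⟩ => hu ⟨t, ht⟩

theorem changesMem_event_reschedule_iff :
    ((e.reschedule φ).event b u).ChangesMem x ↔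
      ∃ t, φ b t = u ∧ (e.event b t).ChangesMem x := by
  simp only [Event.changesMem_iff, assignment_event_reschedule_eq_some_iff hφ he he']
  grind

theorem event_reschedule_eq_rfb (h : e.event (.proc i) t = .rfb x v)
    (hprop : ∀ w s, e.IsLatestWrite i x v w t → e.act s (.disp i) = .prop →
      e.writesBefore i w = e.propsBefore i s → φ (.proc i) t < φ (.disp i) s) :
    (e.reschedule φ).event (.proc i) (φ (.proc i) t) = .rfb x v := by
  obtain ⟨hread, w, hw, -⟩ := he.event_eq_rfb_iff.1 h
  rw [he'.event_eq_rfb_iff, act_reschedule_apply hφ]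
  refine ⟨hread, _, (isLatestWrite_reschedule_iff hφ).2 ⟨w, rfl, hw⟩, ?_⟩
  rw [writesBefore_reschedule_apply hφ]
  by_contra! hlt
  rw [propsBefore_reschedule hφ] at hlt
  obtain ⟨s, hs, hact, hk⟩ := exists_prop_of_lt_propsBefore hlt
  rw [lt_clock_iff (hφ _), Nat.lt_succ_iff] at hs
  exact absurd (hprop w s hw hact hk.symm) (not_lt.2 hs)

end Reschedule

end Execution

namespace Run

variable {n : ℕ} {Var Val Intl Op : Type*} [DecidableEq Var] {r : Run n Var Val Intl Op}
  {i : Fin n} {b c : Agent n} {x : Var} {v : Val} {s t : ℕ}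

/-- A run without its local states. -/
def execution (r : Run n Var Val Intl Op) : Execution n Var Val Intl where
  state t := (r.state t).tso
  act t := (r.joint t).act
  buf_zero := r.buf_zero
  state_succ := r.tso_succ

theorem causal_execution (r : Run n Var Val Intl Op) : r.execution.Causal := by
  refine Execution.causal_of_buf_ne_nil fun t i ht => ?_
  have hen : (r.state t).tso.Enabled (.disp i) (r.execution.act t (.disp i)) := r.enabled t _
  rwa [ht] at hen

theorem writeCount_eq (r : Run n Var Val Intl Op) (i : Fin n) (t : ℕ) :
    r.writeCount i t = r.execution.writesBefore i (t + 1) := by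
  classical exact ncard_setOf_le_and _ t

theorem propCount_eq (r : Run n Var Val Intl Op) (i : Fin n) (t : ℕ) :
    r.propCount i t = r.execution.propsBefore i (t + 1) := by
  have hset : {s | s ≤ t ∧ (r.event (.disp i) s).IsProp} =
      {s | s ≤ t ∧ r.execution.act s (.disp i) = .prop} :=
    Set.ext fun s => and_congr_right' r.causal_execution.isProp_iff
  classical exact (congrArg Set.ncard hset).trans (ncard_setOf_le_and _ t)

theorem writeCount_eq_propCount (hs : r.event (.proc i) s = .write x v)
    (ht : r.action (.disp i) t = .prop)
    (hk : r.execution.writesBefore i s = r.execution.propsBefore i t) :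
    r.writeCount i s = r.propCount i t := by
  rw [writeCount_eq, propCount_eq, Execution.writesBefore_succ_of_write (e := r.execution) hs,
    Execution.propsBefore_succ_of_prop ht, hk]

theorem hasTag_prop (ht : r.action (.disp i) t = .prop) :
    r.HasTag (.disp i) t (i, r.propCount i t) :=
  .prop i t (r.causal_execution.isProp_iff.2 ht)

theorem occursBefore_prop_of_write (hs : r.event (.proc i) s = .write x v)
    (ht : r.action (.disp i) t = .prop)
    (hk : r.execution.writesBefore i s = r.execution.propsBefore i t) :
    r.OccursBefore (.proc i, s) (.disp i, t) := by
  have hst := r.causal_execution.lt_of_writesBefore_eq_propsBefore hs ht hk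
  refine .buffer i s t hst _ (.inl ⟨x, v, hs⟩) (r.causal_execution.isProp_iff.2 ht)
    (.write i s ⟨x, v, hs⟩) ?_
  rw [writeCount_eq_propCount hs ht hk]
  exact hasTag_prop ht

theorem occursBefore_prop_of_rfb {w : ℕ} {v' : Val} (hs : r.event (.proc i) s = .rfb x v)
    (hw : r.execution.IsLatestWrite i x v' w s) (ht : r.action (.disp i) t = .prop)
    (hk : r.execution.writesBefore i w = r.execution.propsBefore i t) :
    r.OccursBefore (.proc i, s) (.disp i, t) := by
  have hst : s < t := by
    obtain ⟨-, w', hw', hle⟩ := r.causal_execution.event_eq_rfb_iff.1 hs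
    rw [← hw.time_eq hw', hk, ← not_lt, Execution.propsBefore_lt_iff ht, Nat.lt_succ_iff] at hle
    exact not_le.1 hle
  refine .buffer i s t hst _ (.inr ⟨x, v, hs⟩) (r.causal_execution.isProp_iff.2 ht)
    (.rfb i w s x v v' hs hw.lt hw.event_eq hw.event_ne) ?_
  rw [writeCount_eq_propCount hw.event_eq ht hk]
  exact hasTag_prop ht

theorem occursBefore_of_changesMem (hb : (r.event b s).ChangesMem x)
    (hc : (r.event c t).ChangesMem x) (hst : s < t) : r.OccursBefore (b, s) (c, t) :=
  .access b c s t hst x hb.accesses hc.accesses (fun h => hb.not_isRfM h.1)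
    fun ⟨_, _, _, _, hR⟩ => hc.not_isRfM hR

theorem occursBefore_of_rfm_of_changesMem (hb : r.event b s = .rfm x v)
    (hc : (r.event c t).ChangesMem x) (hst : s < t) : r.OccursBefore (b, s) (c, t) :=
  .access b c s t hst x (.inr (.inr ⟨v, hb⟩)) hc.accesses (fun h => hc.not_isRfM h.2)
    fun ⟨_, _, _, _, hR⟩ => hc.not_isRfM hR

theorem occursBefore_of_changesMem_of_rfm (hb : (r.event b s).ChangesMem x)
    (hc : r.event (.proc i) t = .rfm x v) (hst : s < t) (hbi : b ≠ .disp i) :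
    r.OccursBefore (b, s) (.proc i, t) :=
  .access b _ s t hst x hb.accesses (.inr (.inr ⟨v, hc⟩)) (fun h => hb.not_isRfM h.1)
    fun ⟨_, hbj, hij, _⟩ => hbi (hbj.trans (congrArg Agent.disp (Agent.proc.inj hij).symm))

theorem eq_of_changesMem (hb : (r.event b t).ChangesMem x) (hc : (r.event c t).ChangesMem x) :
    b = c := by
  by_contra hbc
  refine r.nonconflicting t b c hbc
    ⟨fun h => hb.not_isRfM h.1, ⟨x, hb.accesses, hc.accesses⟩, ?_⟩
  rintro (⟨_, _, _, _, hR⟩ | ⟨_, _, _, _, hR⟩)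
  exacts [hc.not_isRfM hR, hb.not_isRfM hR]

theorem eq_disp_of_changesMem_of_rfm (hb : (r.event b t).ChangesMem x)
    (hc : r.event (.proc i) t = .rfm x v) : b = .disp i := by
  by_contra hbi
  have hne : b ≠ .proc i := by
    rintro rfl
    exact hb.not_isRfM ⟨x, v, hc⟩
  refine r.nonconflicting t b (.proc i) hne
    ⟨fun h => hb.not_isRfM h.1, ⟨x, hb.accesses, .inr (.inr ⟨v, hc⟩)⟩, ?_⟩
  rintro (⟨j, rfl, hij, _⟩ | ⟨j, hij, _⟩)
  · exact hbi (congrArg Agent.disp (Agent.proc.inj hij).symm)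
  · cases hij

theorem mem_succ_of_rfm (h : r.event (.proc i) t = .rfm x v) : (r.state (t + 1)).tso.mem x = v :=
  Execution.mem_succ_of_rfm (e := r.execution) h fun _ hj => by
    cases eq_disp_of_changesMem_of_rfm hj h

theorem hasTag_disp_iff {κ : Tag n} :
    r.HasTag (.disp i) t κ ↔ r.action (.disp i) t = .prop ∧ κ = (i, r.propCount i t) := by
  constructor
  · rintro ⟨⟩
    exact ⟨r.causal_execution.isProp_iff.1 ‹_›, rfl⟩
  · rintro ⟨ht, rfl⟩
    exact hasTag_prop ht

theorem hasTag_proc_iff {κ : Tag n} :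
    r.HasTag (.proc i) t κ ↔
      ((r.event (.proc i) t).IsWrite ∧ κ = (i, r.writeCount i t)) ∨
      (∃ x v, r.event (.proc i) t = .rfb x v ∧
        ∃ w s, r.execution.IsLatestWrite i x w s t ∧ κ = (i, r.writeCount i s)) ∨
      ∃ x v, r.event (.proc i) t = .rfm x v ∧
        ∃ w j s, r.execution.IsLatestAssignment x w (.disp j) s (t + 1) ∧
          κ = (j, r.propCount j s) := by
  constructor
  · rintro (⟨_, _, h⟩ | _ | ⟨_, s, _, x, v, w, h, hst, hs, hlast⟩ |
      ⟨_, j, s, _, x, v, w, h, hst, hs, hlast⟩)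
    · exact .inl ⟨h, rfl⟩
    · exact .inr (.inl ⟨x, v, h, w, s, ⟨hst, hs, hlast⟩, rfl⟩)
    · exact .inr (.inr ⟨x, v, h, w, j, s, ⟨Nat.lt_succ_iff.2 hst, congrArg Event.assignment hs,
        fun u hsu hut => hlast u hsu (Nat.lt_succ_iff.1 hut)⟩, rfl⟩)
  · rintro (⟨h, rfl⟩ | ⟨x, v, h, w, s, hs, rfl⟩ | ⟨x, v, h, w, j, s, hs, rfl⟩)
    · exact .write i t h
    · exact .rfb i s t x v w h hs.lt hs.event_eq hs.event_ne
    · exact .rfm i j s t x v w h (Nat.lt_succ_iff.1 hs.lt)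
        (MemState.assignment_jointEvent_disp_eq_some_iff.1 hs.assignment_eq)
        fun u hsu hut => hs.not_changesMem u hsu (Nat.lt_succ_iff.2 hut)

theorem HasTag.unique {κ κ' : Tag n} (h : r.HasTag b t κ) (h' : r.HasTag b t κ') : κ = κ' := by
  rcases b with i | i
  · rw [hasTag_proc_iff] at h h'
    rcases h with ⟨⟨x, v, h⟩, rfl⟩ | ⟨x, v, h, w, s, hs, rfl⟩ | ⟨x, v, h, w, j, s, hs, rfl⟩ <;>
    simp only [h, Event.IsWrite, reduceCtorEq, exists_false, false_and, false_or, or_false,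
      Event.rfb.injEq, Event.rfm.injEq] at h'
    · exact h'.2.symm
    · obtain ⟨_, _, ⟨rfl, rfl⟩, w', s', hs', rfl⟩ := h'
      rw [hs.time_eq hs']
    · obtain ⟨_, _, ⟨rfl, rfl⟩, w', j', s', hs', rfl⟩ := h'
      obtain rfl := hs.time_eq hs'
      cases eq_of_changesMem hs.changesMem hs'.changesMem
      rfl
  · rw [hasTag_disp_iff] at h h'
    rw [h.2, h'.2]

/-! ### Retimings that preserve the occurs-before relation -/

/-- Moving every action of `r`, that of `b` at time `t` to time `φ b t`, preserves the occurs-before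
relation. -/
def PreservesOccursBefore (r : Run n Var Val Intl Op) (φ : Agent n → ℕ → ℕ) : Prop :=
  ∀ b s c t, r.OccursBefore (b, s) (c, t) → φ b s < φ c t

namespace PreservesOccursBefore

variable {φ : Agent n → ℕ → ℕ} {u : ℕ} {v' : Val} (hφ : r.PreservesOccursBefore φ)

include hφ

theorem strictMono (b : Agent n) : StrictMono (φ b) :=
  fun _ _ h => hφ _ _ _ _ (.locality b _ _ h)

theorem causal_reschedule : (r.execution.reschedule φ).Causal :=
  Execution.causal_reschedule hφ.strictMono
    (fun _ _ _ _ _ hs ht hk => hφ _ _ _ _ (occursBefore_prop_of_write hs ht hk))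
    r.causal_execution

theorem assignment_event_reschedule_eq_some_iff :
    ((r.execution.reschedule φ).event b u).assignment = some (x, v) ↔
      ∃ t, φ b t = u ∧ (r.event b t).assignment = some (x, v) :=
  Execution.assignment_event_reschedule_eq_some_iff hφ.strictMono r.causal_execution
    hφ.causal_reschedule

theorem changesMem_event_reschedule_iff :
    ((r.execution.reschedule φ).event b u).ChangesMem x ↔
      ∃ t, φ b t = u ∧ (r.event b t).ChangesMem x :=
  Execution.changesMem_event_reschedule_iff hφ.strictMono r.causal_execution
    hφ.causal_reschedule

theorem lt_iff_lt_of_changesMem (hb : (r.event b s).ChangesMem x)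
    (hc : (r.event c t).ChangesMem x) : φ b s < φ c t ↔ s < t := by
  refine ⟨fun h => ?_, fun h => hφ _ _ _ _ (occursBefore_of_changesMem hb hc h)⟩
  by_contra! hts
  rcases hts.lt_or_eq with hlt | rfl
  · exact h.not_gt (hφ _ _ _ _ (occursBefore_of_changesMem hc hb hlt))
  · rw [eq_of_changesMem hb hc] at h
    exact h.false

theorem eq_of_changesMem_reschedule
    (hb : ((r.execution.reschedule φ).event b u).ChangesMem x)
    (hc : ((r.execution.reschedule φ).event c u).ChangesMem x) : b = c := by
  obtain ⟨s, rfl, hs⟩ := hφ.changesMem_event_reschedule_iff.1 hb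
  obtain ⟨t, htu, ht⟩ := hφ.changesMem_event_reschedule_iff.1 hc
  have hst : ¬ s < t := fun h => htu.not_gt ((hφ.lt_iff_lt_of_changesMem hs ht).2 h)
  have hts : ¬ t < s := fun h => htu.not_lt ((hφ.lt_iff_lt_of_changesMem ht hs).2 h)
  obtain rfl : s = t := by omega
  exact eq_of_changesMem hs ht

section Mem

variable (hu : ∀ b s, (r.event b s).ChangesMem x → (φ b s < u ↔ s < t))

include hu

theorem isLatestAssignment_reschedule_iff {u' : ℕ} :
    (r.execution.reschedule φ).IsLatestAssignment x v b u' u ↔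
      ∃ s, φ b s = u' ∧ r.execution.IsLatestAssignment x v b s t := by
  constructor
  · rintro ⟨hlt, heq, hne⟩
    obtain ⟨s, rfl, hs⟩ := hφ.assignment_event_reschedule_eq_some_iff.1 heq
    have hsx := Event.changesMem_iff.2 ⟨v, hs⟩
    refine ⟨s, rfl, (hu b s hsx).1 hlt, hs, fun s' hss' hs't c hc => ?_⟩
    exact hne _ ((hφ.lt_iff_lt_of_changesMem hsx hc).2 hss') ((hu c s' hc).2 hs't) c
      (hφ.changesMem_event_reschedule_iff.2 ⟨s', rfl, hc⟩)
  · rintro ⟨s, rfl, hst, hs, hne⟩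
    have hsx := Event.changesMem_iff.2 ⟨v, hs⟩
    refine ⟨(hu b s hsx).2 hst, hφ.assignment_event_reschedule_eq_some_iff.2 ⟨s, rfl, hs⟩,
      fun u' hsu' hu'u c hc => ?_⟩
    obtain ⟨s', rfl, hs'⟩ := hφ.changesMem_event_reschedule_iff.1 hc
    exact hne s' ((hφ.lt_iff_lt_of_changesMem hsx hs').1 hsu') ((hu c s' hs').1 hu'u) c hs'

theorem mem_reschedule_eq :
    ((r.execution.reschedule φ).state u).mem x = (r.state t).tso.mem x := by
  rcases r.execution.exists_isLatestAssignment_or x t with ⟨v, b, s, h⟩ | h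
  · have h' := (hφ.isLatestAssignment_reschedule_iff hu).2 ⟨s, rfl, h⟩
    exact (h'.mem_eq fun _ hc => hφ.eq_of_changesMem_reschedule hc h'.changesMem).trans
      (h.mem_eq fun _ hc => eq_of_changesMem hc h.changesMem).symm
  · have h' : ∀ u' < u, ∀ c, ¬ ((r.execution.reschedule φ).event c u').ChangesMem x := by
      intro u' hu' c hc
      obtain ⟨s, rfl, hs⟩ := hφ.changesMem_event_reschedule_iff.1 hc
      exact h s ((hu c s hs).1 hu') c hs
    exact (Execution.mem_eq_mem_zero h').trans (Execution.mem_eq_mem_zero h).symm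

end Mem

theorem event_reschedule_eq_rfb (h : r.event (.proc i) t = .rfb x v) :
    (r.execution.reschedule φ).event (.proc i) (φ (.proc i) t) = .rfb x v :=
  Execution.event_reschedule_eq_rfb hφ.strictMono r.causal_execution hφ.causal_reschedule h
    fun _ _ hw hs hk => hφ _ _ _ _ (occursBefore_prop_of_rfb h hw hs hk)

theorem lt_succ_iff_of_changesMem_of_rfm (h : r.event (.proc i) t = .rfm x v)
    (h' : (r.execution.reschedule φ).event (.proc i) (φ (.proc i) t) = .rfm x v')
    (hb : (r.event b s).ChangesMem x) : φ b s < φ (.proc i) t + 1 ↔ s < t + 1 := by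
  rw [Nat.lt_succ_iff, Nat.lt_succ_iff]
  refine ⟨fun hle => ?_, fun hst => ?_⟩
  · by_contra! hts
    exact hle.not_gt (hφ _ _ _ _ (occursBefore_of_rfm_of_changesMem h hb hts))
  by_cases hbi : b = .disp i
  · -- The propagation by `d_i` does not occur before the read, but the moved read finds no item
    -- for `x` in the buffer, so the propagation has been performed by then.
    subst hbi
    obtain ⟨hact, w₀, hw₀s, v₀, hw₀, hk⟩ := r.causal_execution.exists_write_of_changesMem_disp hb
    obtain ⟨w, v₁, hw₀w, hw⟩ := Execution.exists_isLatestWrite hw₀ (hw₀s.trans_le hst)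
    have hlt := (hφ.causal_reschedule.event_eq_rfm_iff.1 h').2.1 _ _
      ((Execution.isLatestWrite_reschedule_iff hφ.strictMono).2 ⟨w, rfl, hw⟩)
    rw [Execution.writesBefore_reschedule_apply hφ.strictMono,
      Execution.propsBefore_reschedule hφ.strictMono] at hlt
    have hs := (Execution.writesBefore_mono i hw₀w).trans_lt hlt
    rwa [hk, Execution.propsBefore_lt_iff hact, lt_clock_iff (hφ.strictMono _),
      Nat.lt_succ_iff] at hs
  · have hlt : s < t := hst.lt_of_ne fun hst => hbi (eq_disp_of_changesMem_of_rfm (hst ▸ hb) h)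
    exact (hφ _ _ _ _ (occursBefore_of_changesMem_of_rfm hb h hlt hbi)).le

theorem eq_of_rfm_of_event_reschedule_eq_rfm (h : r.event (.proc i) t = .rfm x v)
    (h' : (r.execution.reschedule φ).event (.proc i) (φ (.proc i) t) = .rfm x v') : v' = v := by
  have hlt := fun b s => hφ.lt_succ_iff_of_changesMem_of_rfm h h' (b := b) (s := s)
  have hproc : ∀ j,
      ¬ ((r.execution.reschedule φ).event (.proc j) (φ (.proc i) t)).ChangesMem x := by
    intro j hj
    obtain ⟨s, hsu, hs⟩ := hφ.changesMem_event_reschedule_iff.1 hj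
    have hst := (hlt _ _ hs).1 (by omega)
    rcases Nat.lt_succ_iff_lt_or_eq.1 hst with hst | rfl
    · exact hsu.not_lt (hφ _ _ _ _ (occursBefore_of_changesMem_of_rfm hs h hst (by simp)))
    · cases eq_disp_of_changesMem_of_rfm hs h
  rw [← Execution.mem_succ_of_rfm h' hproc, hφ.mem_reschedule_eq hlt, mem_succ_of_rfm h]

theorem exists_isLatest_of_event_reschedule_eq_rfb (h : r.event (.proc i) t = .rfm x v)
    (h' : (r.execution.reschedule φ).event (.proc i) (φ (.proc i) t) = .rfb x v') :
    ∃ w s, r.execution.IsLatestWrite i x v' w t ∧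
      r.execution.IsLatestAssignment x v' (.disp i) s (t + 1) ∧
      r.execution.writesBefore i w = r.execution.propsBefore i s := by
  obtain ⟨-, u, hu, hle⟩ := hφ.causal_reschedule.event_eq_rfb_iff.1 h'
  obtain ⟨w, rfl, hw⟩ := (Execution.isLatestWrite_reschedule_iff hφ.strictMono).1 hu
  obtain ⟨s, hst, hact, hk⟩ := Execution.exists_prop_of_lt_propsBefore
    ((r.causal_execution.event_eq_rfm_iff.1 h).2.1 w v' hw)
  have hws := r.causal_execution.lt_of_writesBefore_eq_propsBefore hw.event_eq hact hk.symm
  have hs := r.causal_execution.event_eq_prop_iff.2 ⟨hact, w, hws, hw.event_eq, hk.symm⟩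
  have hφts : φ (.proc i) t < φ (.disp i) s := by
    rwa [Execution.writesBefore_reschedule_apply hφ.strictMono,
      Execution.propsBefore_reschedule hφ.strictMono, ← hk, ← not_lt,
      Execution.propsBefore_lt_iff hact, lt_clock_iff (hφ.strictMono _), not_lt] at hle
  refine ⟨w, s, hw, ⟨hst, congrArg Event.assignment hs, fun u hsu hut c hc => ?_⟩, hk.symm⟩
  by_cases hci : c = .disp i
  · subst hci
    exact r.causal_execution.not_changesMem_disp_of_isLatestWrite hw hact hk.symm hsu
      (Nat.lt_succ_iff.1 hut) hc
  · -- A change at another agent would have to be moved between the read and the propagation,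
    -- although the read has been moved before the propagation.
    have hut' : u < t := (Nat.lt_succ_iff.1 hut).lt_of_ne fun hut =>
      hci (eq_disp_of_changesMem_of_rfm (hut ▸ hc) h)
    have hsu' := hφ _ _ _ _ (occursBefore_of_changesMem (.inr ⟨v', hs⟩) hc hsu)
    have hut' := hφ _ _ _ _ (occursBefore_of_changesMem_of_rfm hc h hut' hci)
    omega

theorem eq_of_rfm_of_event_reschedule_eq_rfb (h : r.event (.proc i) t = .rfm x v)
    (h' : (r.execution.reschedule φ).event (.proc i) (φ (.proc i) t) = .rfb x v') : v' = v := by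
  obtain ⟨w, s, -, hs, -⟩ := hφ.exists_isLatest_of_event_reschedule_eq_rfb h h'
  exact (hs.mem_eq fun _ hc => eq_of_changesMem hc hs.changesMem).symm.trans (mem_succ_of_rfm h)

theorem event_reschedule_eq_or (b : Agent n) (t : ℕ) :
    (r.execution.reschedule φ).event b (φ b t) = r.event b t ∨
      ∃ x v, r.event b t = .rfm x v ∧
        (r.execution.reschedule φ).event b (φ b t) = .rfb x v := by
  rcases b with i | i
  · have hact := Execution.act_reschedule_apply (e := r.execution) hφ.strictMono (.proc i) t
    by_cases hread : ∃ x, r.action (.proc i) t = .read x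
    · obtain ⟨x, hx⟩ := hread
      have hx' := hact.trans hx
      rcases MemState.jointEvent_of_read hx with ⟨v, h⟩ | ⟨v, h⟩
      · exact .inl ((hφ.event_reschedule_eq_rfb h).trans h.symm)
      rcases MemState.jointEvent_of_read hx' with ⟨v', h'⟩ | ⟨v', h'⟩
      · obtain rfl := hφ.eq_of_rfm_of_event_reschedule_eq_rfb h h'
        exact .inr ⟨x, v', h, h'⟩
      · obtain rfl := hφ.eq_of_rfm_of_event_reschedule_eq_rfm h h'
        exact .inl (h'.trans h.symm)
    · exact .inl (MemState.jointEvent_proc_of_not_read hact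
        fun x hx => hread ⟨x, hact.symm.trans hx⟩)
  · exact .inl (Execution.event_disp_reschedule_apply hφ.strictMono r.causal_execution
      hφ.causal_reschedule i t)

theorem entries_event_reschedule (b : Agent n) (t : ℕ) :
    ((r.execution.reschedule φ).event b (φ b t)).entries Op = (r.event b t).entries Op := by
  rcases hφ.event_reschedule_eq_or b t with h | ⟨x, v, h, h'⟩
  · rw [h]
  · rw [h, h', Event.entries, Event.entries]

theorem exists_of_accesses (h : ((r.execution.reschedule φ).event b u).Accesses x) :
    ∃ t, φ b t = u ∧ (r.execution.reschedule φ).event b u = r.event b t := by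
  by_cases hu : u ∈ Set.range (φ b)
  · obtain ⟨t, rfl⟩ := hu
    rcases hφ.event_reschedule_eq_or b t with heq | ⟨y, v, -, hrfb⟩
    · exact ⟨t, rfl, heq⟩
    · simp [hrfb, Event.Accesses] at h
  · simp [Execution.event_reschedule_of_notMem hu, Event.Accesses] at h

theorem not_conflicting_reschedule (u : ℕ) (b c : Agent n) (hbc : b ≠ c) :
    ¬ Conflicting b ((r.execution.reschedule φ).event b u)
      c ((r.execution.reschedule φ).event c u) := by
  rintro ⟨hR, ⟨x, hb, hc⟩, hP⟩
  obtain ⟨s, hsu, hs⟩ := hφ.exists_of_accesses hb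
  obtain ⟨t, htu, ht⟩ := hφ.exists_of_accesses hc
  rw [hs, ht] at hR hP
  rw [hs] at hb
  rw [ht] at hc
  rcases lt_trichotomy s t with hlt | rfl | hlt
  · have := hφ _ _ _ _ (.access b c s t hlt x hb hc hR fun h => hP (.inl h))
    omega
  · exact r.nonconflicting s b c hbc ⟨hR, ⟨x, hb, hc⟩, hP⟩
  · have := hφ _ _ _ _ (.access c b t s hlt x hc hb (fun h => hR h.symm) fun h => hP (.inr h))
    omega

theorem buf_reschedule_eq_nil
    (ht : r.event (.proc i) t = .fence ∨ (r.event (.proc i) t).IsRMW)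
    (hbuf : (r.state t).tso.buf i = []) :
    ((r.execution.reschedule φ).state (φ (.proc i) t)).buf i = [] := by
  rw [hφ.causal_reschedule.buf_eq_nil_iff, Execution.writesBefore_reschedule_apply hφ.strictMono,
    Execution.propsBefore_reschedule hφ.strictMono]
  refine (r.causal_execution.buf_eq_nil_iff.1 hbuf).trans (not_lt.1 fun hlt => ?_)
  obtain ⟨s, hst, hs, hk⟩ := Execution.exists_prop_of_lt_propsBefore hlt
  have hst' := hφ _ _ _ _ (.fence i s t hst (r.causal_execution.isProp_iff.2 hs) ht)
  rw [← lt_clock_iff (hφ.strictMono _), ← Execution.propsBefore_lt_iff hs] at hst'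
  exact hst'.ne hk

theorem mem_reschedule_eq_of_changesMem (h : (r.event b t).ChangesMem x) :
    ((r.execution.reschedule φ).state (φ b t)).mem x = (r.state t).tso.mem x :=
  hφ.mem_reschedule_eq fun _ _ hc => hφ.lt_iff_lt_of_changesMem hc h

theorem enabled_proc_reschedule (i : Fin n) (t : ℕ) :
    ((r.execution.reschedule φ).state (φ (.proc i) t)).Enabled (.proc i)
      (r.action (.proc i) t) := by
  have hen : (r.state t).tso.Enabled (.proc i) (r.action (.proc i) t) := r.enabled t (.proc i)
  cases hact : r.action (.proc i) t with
  | prop => rwa [hact] at hen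
  | fence =>
    rw [hact] at hen
    exact hφ.buf_reschedule_eq_nil (.inl (MemState.jointEvent_eq_fence_iff.2 hact)) hen
  | rmw x v w =>
    rw [hact] at hen
    have ht : r.event (.proc i) t = .rmw x v w := MemState.jointEvent_eq_rmw_iff.2 hact
    exact ⟨hφ.buf_reschedule_eq_nil (.inr ⟨x, v, w, ht⟩) hen.1,
      (hφ.mem_reschedule_eq_of_changesMem (.inl ⟨v, w, ht⟩)).trans hen.2⟩
  | _ => trivial

theorem enabled_disp_reschedule (i : Fin n) (t : ℕ) :
    ((r.execution.reschedule φ).state (φ (.disp i) t)).Enabled (.disp i)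
      (r.action (.disp i) t) := by
  have hen : (r.state t).tso.Enabled (.disp i) (r.action (.disp i) t) := r.enabled t (.disp i)
  cases hact : r.action (.disp i) t with
  | prop =>
    have hle := hφ.causal_reschedule i (φ (.disp i) t)
    have hact' : (r.execution.reschedule φ).act (φ (.disp i) t) (.disp i) = .prop :=
      (Execution.act_reschedule_apply hφ.strictMono (.disp i) t).trans hact
    rw [Execution.propsBefore_succ_of_prop hact', Nat.succ_le_iff, ← not_le,
      ← hφ.causal_reschedule.buf_eq_nil_iff] at hle
    exact hle
  | _ => rwa [hact] at hen

theorem enabled_reschedule (u : ℕ) (b : Agent n) :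
    ((r.execution.reschedule φ).state u).Enabled b ((r.execution.reschedule φ).act u b) := by
  by_cases hu : u ∈ Set.range (φ b)
  · obtain ⟨t, rfl⟩ := hu
    rw [Execution.act_reschedule_apply hφ.strictMono]
    rcases b with i | i
    exacts [hφ.enabled_proc_reschedule i t, hφ.enabled_disp_reschedule i t]
  · rw [Execution.act_reschedule_of_notMem hu]
    exact MemState.enabled_null _ b

/-- The run in which every action of `r` is performed at its new time. Invocations at a process are
moved together with its actions. -/
noncomputable def run : Run n Var Val Intl Op where
  state u := ⟨(r.execution.reschedule φ).state u, fun i => r.loc i (clock (φ (.proc i)) u)⟩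
  joint u := ⟨(r.execution.reschedule φ).act u, fun i =>
    Function.extend (φ (.proc i)) (fun t => (r.joint t).invoke i) (fun _ => none) u⟩
  buf_zero := r.buf_zero
  loc_zero i := by
    change r.loc i (clock (φ (.proc i)) 0) = []
    rw [clock_zero (hφ.strictMono _), loc, r.loc_zero]
  enabled := hφ.enabled_reschedule
  nonconflicting := hφ.not_conflicting_reschedule
  tso_succ _ := rfl
  loc_succ u i := by
    change r.loc i (clock (φ (.proc i)) (u + 1)) = r.loc i (clock (φ (.proc i)) u) ++
      ((r.execution.reschedule φ).event (.proc i) u).entries Op ++ ((Function.extend (φ (.proc i))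
        (fun t => (r.joint t).invoke i) (fun _ => none) u).map Entry.invoke).toList
    by_cases hu : u ∈ Set.range (φ (.proc i))
    · obtain ⟨t, rfl⟩ := hu
      rw [clock_apply_succ (hφ.strictMono _), clock_apply (hφ.strictMono _),
        hφ.entries_event_reschedule, (hφ.strictMono _).injective.extend_apply]
      exact r.loc_succ t i
    · rw [clock_succ_of_notMem_range (hφ.strictMono _) hu, Execution.event_reschedule_of_notMem hu,
        Function.extend_apply' _ _ _ hu]
      simp [Event.entries]

theorem run_state_zero : hφ.run.state 0 = r.state 0 :=
  GlobalState.ext rfl (funext fun i => congrArg (r.loc i) (clock_zero (hφ.strictMono _)))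

theorem run_loc (i : Fin n) (u : ℕ) : hφ.run.loc i u = r.loc i (clock (φ (.proc i)) u) := rfl

theorem run_loc_apply (i : Fin n) (t : ℕ) : hφ.run.loc i (φ (.proc i) t) = r.loc i t := by
  rw [run_loc, clock_apply (hφ.strictMono _)]

theorem run_action_apply (b : Agent n) (t : ℕ) : hφ.run.action b (φ b t) = r.action b t :=
  Execution.act_reschedule_apply hφ.strictMono b t

theorem exists_of_run_action_ne_null (h : hφ.run.action b u ≠ .null) : ∃ t, φ b t = u := by
  by_contra hu
  exact h (Execution.act_reschedule_of_notMem hu)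

theorem run_isRunOf {P : Protocol n Var Val Intl Op} (hr : r.IsRunOf P) : hφ.run.IsRunOf P := by
  intro u i hu
  obtain ⟨t, rfl⟩ := hφ.exists_of_run_action_ne_null hu
  rw [hφ.run_action_apply] at hu ⊢
  rw [hφ.run_loc_apply]
  exact hr t i hu

theorem run_locallyEquivalent : hφ.run.LocallyEquivalent r :=
  fun j _ => ⟨fun ⟨_, hu⟩ => ⟨_, hu⟩, fun ⟨t, ht⟩ => ⟨_, (hφ.run_loc_apply j t).trans ht⟩⟩

theorem run_writeCount (i : Fin n) (t : ℕ) :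
    hφ.run.writeCount i (φ (.proc i) t) = r.writeCount i t := by
  rw [writeCount_eq, writeCount_eq]
  refine (Execution.writesBefore_reschedule hφ.strictMono i _).trans ?_
  rw [clock_apply_succ (hφ.strictMono _)]

theorem run_propCount (i : Fin n) (t : ℕ) :
    hφ.run.propCount i (φ (.disp i) t) = r.propCount i t := by
  rw [propCount_eq, propCount_eq]
  refine (Execution.propsBefore_reschedule hφ.strictMono i _).trans ?_
  rw [clock_apply_succ (hφ.strictMono _)]

theorem run_hasTag_disp_iff {κ : Tag n} :
    hφ.run.HasTag (.disp i) (φ (.disp i) t) κ ↔ r.HasTag (.disp i) t κ := by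
  rw [hasTag_disp_iff, hasTag_disp_iff, hφ.run_action_apply, hφ.run_propCount]

theorem run_exists_isLatestWrite_iff {κ : Tag n} :
    (∃ u, hφ.run.execution.IsLatestWrite i x v u (φ (.proc i) t) ∧
        κ = (i, hφ.run.writeCount i u)) ↔
      ∃ s, r.execution.IsLatestWrite i x v s t ∧ κ = (i, r.writeCount i s) := by
  have hw := fun u => Execution.isLatestWrite_reschedule_iff (e := r.execution) (u := u)
    hφ.strictMono (i := i) (x := x) (v := v) (t := t)
  constructor
  · rintro ⟨u, hu, rfl⟩
    obtain ⟨s, rfl, hs⟩ := (hw u).1 hu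
    exact ⟨s, hs, by rw [hφ.run_writeCount]⟩
  · rintro ⟨s, hs, rfl⟩
    exact ⟨_, (hw _).2 ⟨s, rfl, hs⟩, by rw [hφ.run_writeCount]⟩

theorem run_exists_isLatestAssignment_iff {j : Fin n} {w : Val} {κ : Tag n}
    (h : r.event (.proc i) t = .rfm x v)
    (h' : hφ.run.event (.proc i) (φ (.proc i) t) = .rfm x v) :
    (∃ u, hφ.run.execution.IsLatestAssignment x w (.disp j) u (φ (.proc i) t + 1) ∧
        κ = (j, hφ.run.propCount j u)) ↔
      ∃ s, r.execution.IsLatestAssignment x w (.disp j) s (t + 1) ∧ κ = (j, r.propCount j s) := by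
  have ha := fun u => hφ.isLatestAssignment_reschedule_iff (v := w) (b := .disp j) (u' := u)
    fun _ _ hc => hφ.lt_succ_iff_of_changesMem_of_rfm h h' hc
  constructor
  · rintro ⟨u, hu, rfl⟩
    obtain ⟨s, rfl, hs⟩ := (ha u).1 hu
    exact ⟨s, hs, by rw [hφ.run_propCount]⟩
  · rintro ⟨s, hs, rfl⟩
    exact ⟨_, (ha _).2 ⟨s, rfl, hs⟩, by rw [hφ.run_propCount]⟩

theorem run_hasTag_proc_iff_of_event_eq {κ : Tag n}
    (h : hφ.run.event (.proc i) (φ (.proc i) t) = r.event (.proc i) t) :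
    hφ.run.HasTag (.proc i) (φ (.proc i) t) κ ↔ r.HasTag (.proc i) t κ := by
  rw [hasTag_proc_iff, hasTag_proc_iff, h, hφ.run_writeCount]
  refine or_congr_right (or_congr ?_ ?_)
  · exact exists₂_congr fun x v => and_congr_right fun _ =>
      exists_congr fun w => hφ.run_exists_isLatestWrite_iff
  · exact exists₂_congr fun x v => and_congr_right fun hrfm =>
      exists₂_congr fun w j => hφ.run_exists_isLatestAssignment_iff hrfm (h.trans hrfm)

theorem run_hasTag_proc_iff_of_rfm_of_rfb {κ : Tag n} (h : r.event (.proc i) t = .rfm x v)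
    (h' : hφ.run.event (.proc i) (φ (.proc i) t) = .rfb x v) :
    hφ.run.HasTag (.proc i) (φ (.proc i) t) κ ↔ r.HasTag (.proc i) t κ := by
  obtain ⟨w, s, hw, hs, hk⟩ := hφ.exists_isLatest_of_event_reschedule_eq_rfb h h'
  have hprop : r.action (.disp i) s = .prop := (r.causal_execution.exists_write_of_changesMem_disp
    hs.changesMem).1
  have htag : r.HasTag (.proc i) t (i, r.propCount i s) :=
    hasTag_proc_iff.2 (.inr (.inr ⟨x, v, h, v, i, s, hs, rfl⟩))
  have htag' : hφ.run.HasTag (.proc i) (φ (.proc i) t) (i, r.propCount i s) := by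
    rw [← writeCount_eq_propCount hw.event_eq hprop hk]
    exact hasTag_proc_iff.2
      (.inr (.inl ⟨x, v, h', v, hφ.run_exists_isLatestWrite_iff.2 ⟨w, hw, rfl⟩⟩))
  exact ⟨fun hκ => htag'.unique hκ ▸ htag, fun hκ => htag.unique hκ ▸ htag'⟩

theorem run_hasTag_iff (b : Agent n) (t : ℕ) (κ : Tag n) :
    hφ.run.HasTag b (φ b t) κ ↔ r.HasTag b t κ := by
  rcases b with i | i
  · rcases hφ.event_reschedule_eq_or (.proc i) t with h | ⟨x, v, h, h'⟩
    exacts [hφ.run_hasTag_proc_iff_of_event_eq h, hφ.run_hasTag_proc_iff_of_rfm_of_rfb h h']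
  · exact hφ.run_hasTag_disp_iff

end PreservesOccursBefore

/-! ### Delaying everything outside the past -/

variable {S : Set (Node n)}

theorem OccursBefore.lt {θ θ' : Node n} (h : r.OccursBefore θ θ') : θ.2 < θ'.2 := by
  induction h with
  | locality _ _ _ ht => exact ht
  | buffer _ _ _ ht => exact ht
  | access _ _ _ _ ht => exact ht
  | fence _ _ _ ht => exact ht
  | trans _ _ _ _ _ ih ih' => exact ih.trans ih'

theorem mem_past_of_occursBefore {θ θ' : Node n} (h : r.OccursBefore θ θ')
    (hθ' : θ' ∈ r.PastPlus S) : θ ∈ r.Past S := by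
  rcases hθ' with ⟨θ'', hS, h'⟩ | hS
  · exact ⟨θ'', hS, h.trans _ _ _ h'⟩
  · exact ⟨θ', hS, h⟩

theorem newTime_of_mem (Δ : ℕ) (h : (b, t) ∈ r.Past S) : r.newTime S Δ b t = t :=
  if_pos h

theorem newTime_of_notMem (Δ : ℕ) (h : (b, t) ∉ r.Past S) : r.newTime S Δ b t = t + Δ :=
  if_neg h

theorem le_newTime (r : Run n Var Val Intl Op) (S : Set (Node n)) (Δ : ℕ) (b : Agent n) (t : ℕ) :
    t ≤ r.newTime S Δ b t := by
  rw [newTime]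
  split_ifs <;> omega

theorem newTime_le (r : Run n Var Val Intl Op) (S : Set (Node n)) (Δ : ℕ) (b : Agent n) (t : ℕ) :
    r.newTime S Δ b t ≤ t + Δ := by
  rw [newTime]
  split_ifs <;> omega

theorem preservesOccursBefore_newTime (r : Run n Var Val Intl Op) (S : Set (Node n)) (Δ : ℕ) :
    r.PreservesOccursBefore (r.newTime S Δ) := by
  intro b s c t h
  have hst : s < t := h.lt
  by_cases hc : (c, t) ∈ r.Past S
  · rwa [newTime_of_mem Δ (mem_past_of_occursBefore h (.inl hc)), newTime_of_mem Δ hc]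
  · rw [newTime_of_notMem Δ hc]
    exact (r.newTime_le S Δ b s).trans_lt (by omega)

theorem clock_newTime_of_mem (Δ : ℕ) (h : (b, t) ∈ r.PastPlus S) :
    clock (r.newTime S Δ b) t = t := by
  refine eq_of_forall_lt_iff fun s => ?_
  rw [lt_clock_iff ((r.preservesOccursBefore_newTime S Δ).strictMono b)]
  refine ⟨(r.le_newTime S Δ b s).trans_lt, fun hst => ?_⟩
  rwa [newTime_of_mem Δ (mem_past_of_occursBefore (.locality b s t hst) h)]

theorem clock_newTime_of_notMem (Δ : ℕ) (h : (b, t) ∉ r.PastPlus S) :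
    clock (r.newTime S Δ b) (t + Δ) = t := by
  have hmono := (r.preservesOccursBefore_newTime S Δ).strictMono b
  refine eq_of_forall_lt_iff fun s => ?_
  rw [lt_clock_iff hmono, ← newTime_of_notMem Δ fun ht => h (.inl ht), hmono.lt_iff_lt]

end Run

end TSO

theorem mainTheorem1_general {n : ℕ} {Var Val Intl Op : Type*} [DecidableEq Var]
    (P : TSO.Protocol n Var Val Intl Op) (r : TSO.Run n Var Val Intl Op) (hr : r.IsRunOf P)
    (S : Set (TSO.Node n)) (Δ : ℕ) :
    ∃ r' : TSO.Run n Var Val Intl Op,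
      r'.IsRunOf P ∧ r'.LocallyEquivalent r ∧ r'.state 0 = r.state 0 ∧
      (∀ b, StrictMono (r.newTime S Δ b) ∧
        (∀ t, r'.action b (r.newTime S Δ b t) = r.action b t) ∧
        (∀ t κ, r'.HasTag b (r.newTime S Δ b t) κ ↔ r.HasTag b t κ) ∧
        (∀ t', r'.action b t' ≠ .null → ∃ t, r.newTime S Δ b t = t')) ∧
      (∀ j t, ((TSO.Agent.proc j, t) ∈ r.PastPlus S → r.loc j t = r'.loc j t) ∧
        ((TSO.Agent.proc j, t) ∉ r.PastPlus S → r.loc j t = r'.loc j (t + Δ))) := by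
  have h := r.preservesOccursBefore_newTime S Δ
  refine ⟨h.run, h.run_isRunOf hr, h.run_locallyEquivalent, h.run_state_zero,
    fun b => ⟨h.strictMono b, h.run_action_apply b, h.run_hasTag_iff b,
      fun _ => h.exists_of_run_action_ne_null⟩,
    fun j t => ⟨fun ht => ?_, fun ht => ?_⟩⟩
  · rw [h.run_loc, TSO.Run.clock_newTime_of_mem Δ ht]
  · rw [h.run_loc, TSO.Run.clock_newTime_of_notMem Δ ht]

theorem mainTheorem1 {n : ℕ} {Var Val Intl Op : Type*} [DecidableEq Var]
    (P : TSO.Protocol n Var Val Intl Op) (r : TSO.Run n Var Val Intl Op) (hr : r.IsRunOf P)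
    (S : Set (TSO.Node n)) (hS : S.Finite) (Δ : ℕ) :
    ∃ r' : TSO.Run n Var Val Intl Op,
      r'.IsRunOf P ∧ r'.LocallyEquivalent r ∧ r'.state 0 = r.state 0 ∧
      -- (a) the same actions, with the same tags, in the same order, at the new times
      (∀ b, StrictMono (r.newTime S Δ b) ∧
        (∀ t, r'.action b (r.newTime S Δ b t) = r.action b t) ∧
        (∀ t κ, r'.HasTag b (r.newTime S Δ b t) κ ↔ r.HasTag b t κ) ∧
        (∀ t', r'.action b t' ≠ .null → ∃ t, r.newTime S Δ b t = t')) ∧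
      -- (b) the local states are shifted accordingly
      (∀ j t, ((TSO.Agent.proc j, t) ∈ r.PastPlus S → r.loc j t = r'.loc j t) ∧
        ((TSO.Agent.proc j, t) ∉ r.PastPlus S → r.loc j t = r'.loc j (t + Δ))) :=
  mainTheorem1_general P r hr S Δ
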